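/- Let $\varphi$ be a smooth real function on $[-1,1]$, $\lambda(t)=e^{-i\varphi(t)}$, $\bar\lambda(t)=e^{i\varphi(t)}$. Let $\mathcal K\subseteq C^\infty([-1,1],\mathbb C)$ be any unital complex subalgebra containing $t,\lambda,\bar\lambda$ and closed under $f\mapsto\dot f=df/dt$ (for example all of $C^\infty([-1,1],\mathbb C)$). Let $\mathcal S^4_\lambda$ be the algebra generated by $\mathcal K$, whose elements are central, and by $(x^1,x^2,x^3,x^4)=(a,a^*,b,b^*)$, subject to $$x^ix^j=A_{ij}\,x^jx^i,\qquad aa^*+bb^*+t^2=1,\qquad A=\begin{pmatrix}1&1&\lambda&\bar\lambda\\1&1&\bar\lambda&\lambda\\\bar\lambda&\lambda&1&1\\\lambda&\bar\lambda&1&1\end{pmatrix}.$$ Put $B_{ij}=A_{ij}^{-1}\dot A_{ij}$. Let $(\Omega_u(\mathcal S^4_\lambda),d)$ be the universal differential graded algebra of the complex algebra $\mathcal S^4_\lambda$, and let $\mathcal J^1\subset\Omega^1_u(\mathcal S^4_\lambda)$ be the sub-bimodule generated by the relations $$df=\dot f\,dt\ (f\in\mathcal K),\qquad y\,dt=dt\,y\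 (y\in\mathcal S^4_\lambda),\qquad t\,dx^i=dx^i\,t,$$ $$x^i\,dx^j=A_{ij}\,dx^j\,x^i+\tfrac12B_{ij}\,dt\,x^ix^j,\qquad a\,da^*+a^*\,da+b\,db^*+b^*\,db+2t\,dt=0.$$ Let $\Omega(\mathcal S^4_\lambda)$ be the quotient of $\Omega_u(\mathcal S^4_\lambda)$ by the two-sided (differential) ideal generated by $\mathcal J^1+d\mathcal J^1$, and let $\Omega^4(\mathcal S^4_\lambda)$ be its part of degree $4$, that is, the span of the forms $y_0\,dy_1\,dy_2\,dy_3\,dy_4$ with $y_k\in\mathcal S^4_\lambda$. Then $\Omega^4(\mathcal S^4_\lambda)$ is a free bimodule of rank one over $\mathcal S^4_\lambda$ with the central generator $$\omega=\tfrac14\left(t\,da\,da^*\,db\,db^*-2a\,dt\,da^*\,db\,db^*+2\,dt\,da\,da^*\,db\,b^*\right).$$ This means that $\omega\in\Omega^4(\mathcal S^4_\lambda)$, that $y\,\omega=\omega\,y$ for all $y\in\mathcal S^4_\lambda$, and that $y\mapsto y\,\omega$ is an isomorphism of $\mathcal S^4_\lambda$-bimodules $\mathcal S^4_\lambda\to\Omega^4(\mathcal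 S^4_\lambda)$. Moreover $$t\,\omega=\tfrac14\,da\,da^*\,db\,db^*,\quad a\,\omega=\tfrac12\,dt\,da\,db\,db^*,\quad a^*\omega=-\tfrac12\,dt\,da^*\,db\,db^*,$$ $$\omega\,b=\tfrac12\,dt\,da\,da^*\,db,\qquad \omega\,b^*=-\tfrac12\,dt\,da\,da^*\,db^*.$$ -/

import Mathlib

open scoped ContDiff

namespace DynSphere

/-! ### Smooth functions on the interval `[-1, 1]` -/

/-- The extension of a function on `[-1, 1]` to the real line (constant outside `[-1, 1]`); only
its restriction to `[-1, 1]` is ever used. -/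
noncomputable def extend (f : Set.Icc (-1 : ℝ) 1 → ℂ) : ℝ → ℂ :=
  Set.IccExtend (by norm_num : (-1 : ℝ) ≤ 1) f

theorem extend_of_mem (f : Set.Icc (-1 : ℝ) 1 → ℂ) {x : ℝ} (hx : x ∈ Set.Icc (-1 : ℝ) 1) :
    extend f x = f ⟨x, hx⟩ :=
  Set.IccExtend_of_mem _ f hx

/-- The algebra `C^∞([-1, 1])` of smooth complex valued functions (one-sided derivatives at the
end points). -/
noncomputable def smoothFun : Subalgebra ℂ (Set.Icc (-1 : ℝ) 1 → ℂ) where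
  carrier := {f | ContDiffOn ℝ ∞ (extend f) (Set.Icc (-1) 1)}
  mul_mem' {_ _} hf hg := ContDiffOn.mul hf hg
  add_mem' {_ _} hf hg := ContDiffOn.add hf hg
  algebraMap_mem' c := (contDiffOn_const (c := c) : ContDiffOn ℝ ∞ (fun _ : ℝ => c) _)

/-- The derivative of a function on `[-1, 1]`. -/
noncomputable def derivFun (f : Set.Icc (-1 : ℝ) 1 → ℂ) : Set.Icc (-1 : ℝ) 1 → ℂ :=
  fun x => derivWithin (extend f) (Set.Icc (-1) 1) x

theorem uniqueDiffOn_interval : UniqueDiffOn ℝ (Set.Icc (-1 : ℝ) 1) :=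
  uniqueDiffOn_Icc (by norm_num)

theorem derivFun_mem {f : Set.Icc (-1 : ℝ) 1 → ℂ} (hf : f ∈ smoothFun) :
    derivFun f ∈ smoothFun := by
  have h : ContDiffOn ℝ ∞ (derivWithin (extend f) (Set.Icc (-1) 1)) (Set.Icc (-1) 1) :=
    ContDiffOn.derivWithin (n := ∞) hf uniqueDiffOn_interval (by simp)
  exact h.congr fun x hx => extend_of_mem _ hx

theorem differentiableOn_extend (f : smoothFun) :
    DifferentiableOn ℝ (extend f) (Set.Icc (-1) 1) :=
  ContDiffOn.differentiableOn (n := ∞) f.2 (by simp)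

/-- The derivation `f ↦ f'` of `C^∞([-1, 1])`. -/
noncomputable def ddt : Derivation ℂ smoothFun smoothFun :=
  Derivation.mk'
    { toFun := fun f => ⟨derivFun f, derivFun_mem f.2⟩
      map_add' := fun f g => by
        ext x
        exact derivWithin_add (differentiableOn_extend f x x.2) (differentiableOn_extend g x x.2)
      map_smul' := fun c f => by
        ext x
        exact derivWithin_const_smul c (differentiableOn_extend f x x.2) }
    (fun f g => by
      ext x
      refine (derivWithin_mul (differentiableOn_extend f x x.2)
        (differentiableOn_extend g x x.2)).trans ?_
      have hf : extend f x = (f : Set.Icc (-1 : ℝ) 1 → ℂ) x := extend_of_mem _ x.2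
      have hg : extend g x = (g : Set.Icc (-1 : ℝ) 1 → ℂ) x := extend_of_mem _ x.2
      rw [hf, hg]
      change derivFun f x * _ + _ * derivFun g x = _ * derivFun g x + _ * derivFun f x
      ring)

/-- The coordinate function `t`. -/
noncomputable def coordT : smoothFun :=
  ⟨fun x => ((x : ℝ) : ℂ), by
    have h : ContDiffOn ℝ ∞ (fun x : ℝ => (x : ℂ)) (Set.Icc (-1) 1) :=
      Complex.ofRealCLM.contDiff.contDiffOn
    exact h.congr fun x hx => extend_of_mem _ hx⟩

/-- The function `exp (i φ(t))`, for a real smooth function `φ` on `[-1, 1]`. -/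
noncomputable def phase (φ : ℝ → ℝ) (hφ : ContDiffOn ℝ ∞ φ (Set.Icc (-1) 1)) : smoothFun :=
  ⟨fun x => Complex.exp (Complex.I * φ x), by
    have h : ContDiffOn ℝ ∞ (fun x : ℝ => Complex.exp (Complex.I * φ x)) (Set.Icc (-1) 1) :=
      Complex.contDiff_exp.comp_contDiffOn
        (contDiffOn_const.mul (Complex.ofRealCLM.contDiff.comp_contDiffOn hφ))
    exact h.congr fun x hx => extend_of_mem _ hx⟩

/-- `λ(t) = exp (-i φ(t))`. -/
noncomputable def lam (φ : ℝ → ℝ) (hφ : ContDiffOn ℝ ∞ φ (Set.Icc (-1) 1)) : smoothFun :=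
  phase (fun x => -φ x) hφ.neg

/-- `λ̄(t) = exp (i φ(t))`, the inverse of `λ(t)`. -/
noncomputable def lamBar (φ : ℝ → ℝ) (hφ : ContDiffOn ℝ ∞ φ (Set.Icc (-1) 1)) : smoothFun :=
  phase φ hφ

/-- An admissible algebra of coefficient functions of the central variable `t`: a subalgebra of
`C^∞([-1, 1])` that contains `t`, `λ(t)` and `λ̄(t)` and is closed under differentiation. -/
structure Coeff (φ : ℝ → ℝ) (hφ : ContDiffOn ℝ ∞ φ (Set.Icc (-1) 1)) where
  /-- the underlying subalgebra -/
  alg : Subalgebra ℂ smoothFun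
  coordT_mem : coordT ∈ alg
  lam_mem : lam φ hφ ∈ alg
  lamBar_mem : lamBar φ hφ ∈ alg
  ddt_mem : ∀ f ∈ alg, ddt f ∈ alg

namespace Coeff

variable {φ : ℝ → ℝ} {hφ : ContDiffOn ℝ ∞ φ (Set.Icc (-1) 1)} (K : Coeff φ hφ)

/-- The coefficient algebra, as a type. -/
def Fun : Type := K.alg

noncomputable instance : CommRing K.Fun := inferInstanceAs (CommRing K.alg)
noncomputable instance : Algebra ℂ K.Fun := inferInstanceAs (Algebra ℂ K.alg)

/-- `t` as a coefficient. -/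
noncomputable def t : K.Fun := (⟨coordT, K.coordT_mem⟩ : K.alg)

/-- `λ(t)` as a coefficient. -/
noncomputable def l : K.Fun := (⟨lam φ hφ, K.lam_mem⟩ : K.alg)

/-- `λ̄(t)` as a coefficient. -/
noncomputable def lbar : K.Fun := (⟨lamBar φ hφ, K.lamBar_mem⟩ : K.alg)

/-- The derivative of a coefficient. -/
noncomputable def deriv (f : K.Fun) : K.Fun :=
  (⟨ddt (show K.alg from f).1, K.ddt_mem _ (show K.alg from f).2⟩ : K.alg)

/-- The matrix `A_{ij}` of commutation factors; the indices `0, 1, 2, 3` stand for the generators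
`a, a*, b, b*`. -/
noncomputable def A : Matrix (Fin 4) (Fin 4) K.Fun :=
  !![1, 1, K.l, K.lbar;
     1, 1, K.lbar, K.l;
     K.lbar, K.l, 1, 1;
     K.l, K.lbar, 1, 1]

/-- The antisymmetric matrix `B_{ij} = A_{ij}⁻¹ (d/dt) A_{ij}`; note that `A_{ij}⁻¹ = A_{ji}`. -/
noncomputable def B : Matrix (Fin 4) (Fin 4) K.Fun :=
  Matrix.of fun i j => K.A j i * K.deriv (K.A i j)

/-! ### The algebra of the sphere -/

/-- The defining relations of the sphere algebra, among noncommuting symbols `x⁰, x¹, x², x³`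
(that is `a, a*, b, b*`) over the coefficient algebra, whose elements are central. -/
inductive SphereRel : FreeAlgebra K.Fun (Fin 4) → FreeAlgebra K.Fun (Fin 4) → Prop
  | comm (i j : Fin 4) :
      SphereRel (FreeAlgebra.ι K.Fun i * FreeAlgebra.ι K.Fun j)
        (K.A i j • (FreeAlgebra.ι K.Fun j * FreeAlgebra.ι K.Fun i))
  | sphere :
      SphereRel (FreeAlgebra.ι K.Fun 0 * FreeAlgebra.ι K.Fun 1
        + FreeAlgebra.ι K.Fun 2 * FreeAlgebra.ι K.Fun 3
        + algebraMap K.Fun (FreeAlgebra K.Fun (Fin 4)) (K.t ^ 2)) 1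

/-- The algebra `S⁴_λ` of the noncommutative sphere. -/
def Sphere : Type := RingQuot K.SphereRel

noncomputable instance : Ring K.Sphere := inferInstanceAs (Ring (RingQuot K.SphereRel))
noncomputable instance : Algebra K.Fun K.Sphere :=
  inferInstanceAs (Algebra K.Fun (RingQuot K.SphereRel))
noncomputable instance : Algebra ℂ K.Sphere :=
  inferInstanceAs (Algebra ℂ (RingQuot K.SphereRel))

/-- The generators `a, a*, b, b*` of `S⁴_λ`. -/
noncomputable def x (i : Fin 4) : K.Sphere :=
  RingQuot.mkAlgHom K.Fun K.SphereRel (FreeAlgebra.ι K.Fun i)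

/-- A function of `t`, as an element of `S⁴_λ`. -/
noncomputable def fn : K.Fun →+* K.Sphere := algebraMap K.Fun K.Sphere

end Coeff

/-! ### The universal differential algebra of a complex algebra -/

/-- The defining relations of the universal differential graded algebra of `A`, among symbols
`x` (`Sum.inl x`) and `dx` (`Sum.inr x`), for `x ∈ A`: the algebra structure of `A` is kept, and
`d` is linear and satisfies the Leibniz rule. -/
inductive UnivRel (A : Type*) [Ring A] [Algebra ℂ A] :
    FreeAlgebra ℂ (A ⊕ A) → FreeAlgebra ℂ (A ⊕ A) → Prop
  | of_add (x y : A) : UnivRel A (FreeAlgebra.ι ℂ (Sum.inl (x + y)))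
      (FreeAlgebra.ι ℂ (Sum.inl x) + FreeAlgebra.ι ℂ (Sum.inl y))
  | of_mul (x y : A) : UnivRel A (FreeAlgebra.ι ℂ (Sum.inl (x * y)))
      (FreeAlgebra.ι ℂ (Sum.inl x) * FreeAlgebra.ι ℂ (Sum.inl y))
  | of_scalar (c : ℂ) : UnivRel A (FreeAlgebra.ι ℂ (Sum.inl (algebraMap ℂ A c)))
      (algebraMap ℂ (FreeAlgebra ℂ (A ⊕ A)) c)
  | d_add (x y : A) : UnivRel A (FreeAlgebra.ι ℂ (Sum.inr (x + y)))
      (FreeAlgebra.ι ℂ (Sum.inr x) + FreeAlgebra.ι ℂ (Sum.inr y))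
  | d_smul (c : ℂ) (x : A) : UnivRel A (FreeAlgebra.ι ℂ (Sum.inr (c • x)))
      (c • FreeAlgebra.ι ℂ (Sum.inr x))
  | d_mul (x y : A) : UnivRel A (FreeAlgebra.ι ℂ (Sum.inr (x * y)))
      (FreeAlgebra.ι ℂ (Sum.inr x) * FreeAlgebra.ι ℂ (Sum.inl y)
        + FreeAlgebra.ι ℂ (Sum.inl x) * FreeAlgebra.ι ℂ (Sum.inr y))

/-- The universal differential graded algebra `Ω_u(A)`. -/
def Univ (A : Type*) [Ring A] [Algebra ℂ A] : Type _ := RingQuot (UnivRel A)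

namespace Univ

variable (A : Type*) [Ring A] [Algebra ℂ A]

noncomputable instance : Ring (Univ A) := inferInstanceAs (Ring (RingQuot (UnivRel A)))
noncomputable instance : Algebra ℂ (Univ A) := inferInstanceAs (Algebra ℂ (RingQuot (UnivRel A)))

/-- The quotient map from the free algebra. -/
noncomputable def mk : FreeAlgebra ℂ (A ⊕ A) →ₐ[ℂ] Univ A := RingQuot.mkAlgHom ℂ (UnivRel A)

variable {A}

theorem mk_rel {p q : FreeAlgebra ℂ (A ⊕ A)} (h : UnivRel A p q) : mk A p = mk A q :=
  RingQuot.mkAlgHom_rel ℂ h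

/-- Extension of a map on the symbols that respects the relations. -/
noncomputable def lift {R : Type*} [Ring R] [Algebra ℂ R] (f : A ⊕ A → R)
    (hf : ∀ ⦃p q⦄, UnivRel A p q → FreeAlgebra.lift ℂ f p = FreeAlgebra.lift ℂ f q) :
    Univ A →ₐ[ℂ] R :=
  RingQuot.liftAlgHom ℂ ⟨FreeAlgebra.lift ℂ f, hf⟩

theorem lift_mk {R : Type*} [Ring R] [Algebra ℂ R] (f : A ⊕ A → R)
    (hf : ∀ ⦃p q⦄, UnivRel A p q → FreeAlgebra.lift ℂ f p = FreeAlgebra.lift ℂ f q)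
    (p : FreeAlgebra ℂ (A ⊕ A)) : lift f hf (mk A p) = FreeAlgebra.lift ℂ f p :=
  RingQuot.liftAlgHom_mkAlgHom_apply ℂ _ hf p

/-- The element `x ∈ A` of degree zero. -/
noncomputable def of (x : A) : Univ A := mk A (FreeAlgebra.ι ℂ (Sum.inl x))

/-- The one-form `dx`, for `x ∈ A`. -/
noncomputable def δ (x : A) : Univ A := mk A (FreeAlgebra.ι ℂ (Sum.inr x))

theorem of_add (x y : A) : of (x + y) = of x + of y := by
  simpa [of] using mk_rel (UnivRel.of_add x y)

theorem of_mul (x y : A) : of (x * y) = of x * of y := by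
  simpa [of] using mk_rel (UnivRel.of_mul x y)

theorem of_scalar (c : ℂ) : of (algebraMap ℂ A c) = algebraMap ℂ (Univ A) c := by
  simpa [of] using mk_rel (UnivRel.of_scalar c)

theorem δ_add (x y : A) : δ (x + y) = δ x + δ y := by
  simpa [δ] using mk_rel (UnivRel.d_add x y)

theorem δ_smul (c : ℂ) (x : A) : δ (c • x) = c • δ x := by
  simpa [δ] using mk_rel (UnivRel.d_smul c x)

theorem δ_mul (x y : A) : δ (x * y) = δ x * of y + of x * δ y := by
  simpa [of, δ] using mk_rel (UnivRel.d_mul x y)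

theorem δ_scalar (c : ℂ) : δ (algebraMap ℂ A c) = 0 := by
  have h1 : δ (1 : A) = 0 := by
    have h := δ_mul (1 : A) 1
    have h0 : of (1 : A) = 1 := by simpa using of_scalar (A := A) 1
    rw [h0] at h
    simpa using h
  rw [Algebra.algebraMap_eq_smul_one, δ_smul, h1, smul_zero]

/-- The values on the symbols of the algebra map `w ↦ (σ w, dw; 0, w)`, where `σ` is
multiplication by `(-1)^n` in degree `n`. Multiplicativity of this map is the graded Leibniz rule
`d(v w) = dv w + σ(v) dw`. -/
noncomputable def dSymbol : A ⊕ A → Matrix (Fin 2) (Fin 2) (Univ A)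
  | Sum.inl x => !![of x, δ x; 0, of x]
  | Sum.inr x => !![-δ x, 0; 0, δ x]

/-- The algebra map `w ↦ (σ w, dw; 0, w)`. -/
noncomputable def dMatrix : Univ A →ₐ[ℂ] Matrix (Fin 2) (Fin 2) (Univ A) :=
  lift dSymbol (by
    intro p q h
    cases h with
    | of_add x y => simp [dSymbol, of_add, δ_add]
    | of_mul x y => simp [dSymbol, of_mul, δ_mul, add_comm]
    | of_scalar c =>
      ext i j
      fin_cases i <;> fin_cases j <;>
        simp [dSymbol, of_scalar, δ_scalar, Matrix.algebraMap_matrix_apply]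
    | d_add x y => simp [dSymbol, δ_add, add_comm]
    | d_smul c x => simp [dSymbol, δ_smul]
    | d_mul x y => simp [dSymbol, δ_mul, add_comm])

/-- The differential of the universal differential graded algebra. -/
noncomputable def d : Univ A →ₗ[ℂ] Univ A where
  toFun w := dMatrix w 0 1
  map_add' v w := by simp
  map_smul' c w := by simp

theorem d_of (x : A) : d (of x) = δ x := by
  simp [d, dMatrix, of, lift_mk, dSymbol]

theorem d_δ (x : A) : d (δ x) = 0 := by
  simp [d, dMatrix, δ, lift_mk, dSymbol]

theorem d_of_mul (x : A) (w : Univ A) : d (of x * w) = δ x * w + of x * d w := by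
  have h1 : dMatrix (of x) = !![of x, δ x; 0, of x] := by
    simp [dMatrix, of, lift_mk, dSymbol]
  have h2 : ∀ w : Univ A, dMatrix w 1 1 = w := by
    intro w
    obtain ⟨p, rfl⟩ := RingQuot.mkAlgHom_surjective ℂ (UnivRel A) w
    change dMatrix (mk A p) 1 1 = mk A p
    have h3 : ∀ p : FreeAlgebra ℂ (A ⊕ A),
        dMatrix (mk A p) 1 0 = 0 ∧ dMatrix (mk A p) 1 1 = mk A p := by
      intro p
      induction p using FreeAlgebra.induction with
      | grade0 c => simp [Matrix.algebraMap_matrix_apply]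
      | grade1 s =>
        rcases s with s | s <;> simp [dMatrix, lift_mk, dSymbol, of, δ]
      | mul p q hp hq => simp [Matrix.mul_apply, hp, hq]
      | add p q hp hq => simp [hp, hq]
    exact (h3 p).2
  change dMatrix (of x * w) 0 1 = δ x * w + of x * dMatrix w 0 1
  rw [map_mul, h1, Matrix.mul_apply, Fin.sum_univ_two, h2]
  simp [add_comm]

end Univ

/-! ### The differential algebra of the sphere -/

namespace Coeff

variable {φ : ℝ → ℝ} {hφ : ContDiffOn ℝ ∞ φ (Set.Icc (-1) 1)} (K : Coeff φ hφ)

/-- The relations that define the bimodule of one-forms: `OneFormRel w` says that `w = 0` is one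
of the relations. -/
inductive OneFormRel : Univ K.Sphere → Prop
  | chain (f : K.Fun) :
      OneFormRel (Univ.δ (K.fn f) - Univ.of (K.fn (K.deriv f)) * Univ.δ (K.fn K.t))
  | dt_central (y : K.Sphere) :
      OneFormRel (Univ.of y * Univ.δ (K.fn K.t) - Univ.δ (K.fn K.t) * Univ.of y)
  | t_comm (i : Fin 4) :
      OneFormRel (Univ.of (K.fn K.t) * Univ.δ (K.x i) - Univ.δ (K.x i) * Univ.of (K.fn K.t))
  | x_dx (i j : Fin 4) :
      OneFormRel (Univ.of (K.x i) * Univ.δ (K.x j)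
        - (Univ.of (K.fn (K.A i j)) * Univ.δ (K.x j) * Univ.of (K.x i)
          + (1 / 2 : ℂ) • (Univ.of (K.fn (K.B i j)) * Univ.δ (K.fn K.t)
            * Univ.of (K.x i * K.x j))))
  | sphere :
      OneFormRel (Univ.of (K.x 0) * Univ.δ (K.x 1) + Univ.of (K.x 1) * Univ.δ (K.x 0)
        + Univ.of (K.x 2) * Univ.δ (K.x 3) + Univ.of (K.x 3) * Univ.δ (K.x 2)
        + (2 : ℂ) • (Univ.of (K.fn K.t) * Univ.δ (K.fn K.t)))

/-- The sub-bimodule `J¹` of the universal one-forms that is generated by the relations. -/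
noncomputable def J : Submodule ℂ (Univ K.Sphere) :=
  Submodule.span ℂ {w | ∃ y z : K.Sphere, ∃ r, K.OneFormRel r ∧ w = Univ.of y * r * Univ.of z}

/-- The elements of `J¹` and of `d J¹` are set to zero. (As `d ∘ d = 0`, the two-sided ideal that
they generate is the differential ideal generated by `J¹`.) -/
inductive FormRel : Univ K.Sphere → Univ K.Sphere → Prop
  | zero (w : Univ K.Sphere) (hw : w ∈ K.J) : FormRel w 0
  | d_zero (w : Univ K.Sphere) (hw : w ∈ K.J) : FormRel (Univ.d w) 0

/-- The differential algebra `Ω(S⁴_λ)`. -/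
def Forms : Type := RingQuot K.FormRel

noncomputable instance : Ring K.Forms := inferInstanceAs (Ring (RingQuot K.FormRel))
noncomputable instance : Algebra ℂ K.Forms := inferInstanceAs (Algebra ℂ (RingQuot K.FormRel))

/-- The projection `Ω_u(S⁴_λ) → Ω(S⁴_λ)`. -/
noncomputable def proj : Univ K.Sphere →ₐ[ℂ] K.Forms := RingQuot.mkAlgHom ℂ K.FormRel

/-- An element of `S⁴_λ` as a form of degree zero. -/
noncomputable def form (y : K.Sphere) : K.Forms := K.proj (Univ.of y)

/-- The one-form `dy`, for `y ∈ S⁴_λ`. -/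
noncomputable def dform (y : K.Sphere) : K.Forms := K.proj (Univ.δ y)

/-- The forms of degree `n`: sums of forms `y₀ dy₁ ⋯ dyₙ`. -/
noncomputable def formsOfDegree (n : ℕ) : Submodule ℂ K.Forms :=
  Submodule.span ℂ {θ | ∃ (y₀ : K.Sphere) (y : Fin n → K.Sphere),
    θ = K.form y₀ * (List.ofFn fun i => K.dform (y i)).prod}

/-- The coordinate `t` as a form of degree zero. -/
noncomputable abbrev ft : K.Forms := K.form (K.fn K.t)
/-- The generator `a` as a form of degree zero. -/
noncomputable abbrev fa : K.Forms := K.form (K.x 0)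
/-- The generator `a*` as a form of degree zero. -/
noncomputable abbrev fa' : K.Forms := K.form (K.x 1)
/-- The generator `b` as a form of degree zero. -/
noncomputable abbrev fb : K.Forms := K.form (K.x 2)
/-- The generator `b*` as a form of degree zero. -/
noncomputable abbrev fb' : K.Forms := K.form (K.x 3)
/-- The one-form `dt`. -/
noncomputable abbrev dt : K.Forms := K.dform (K.fn K.t)
/-- The one-form `da`. -/
noncomputable abbrev da : K.Forms := K.dform (K.x 0)
/-- The one-form `da*`. -/
noncomputable abbrev da' : K.Forms := K.dform (K.x 1)
/-- The one-form `db`. -/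
noncomputable abbrev db : K.Forms := K.dform (K.x 2)
/-- The one-form `db*`. -/
noncomputable abbrev db' : K.Forms := K.dform (K.x 3)

/-- The four-form `ω = ¼ (t da da* db db* - 2 a dt da* db db* + 2 dt da da* db b*)`. -/
noncomputable def vol : K.Forms :=
  (1 / 4 : ℂ) • (K.ft * K.da * K.da' * K.db * K.db'
    - (2 : ℂ) • (K.fa * K.dt * K.da' * K.db * K.db')
    + (2 : ℂ) • (K.dt * K.da * K.da' * K.db * K.fb'))

end Coeff

end DynSphere

namespace DynSphere

namespace Coeff

variable {φ : ℝ → ℝ} {hφ : ContDiffOn ℝ ∞ φ (Set.Icc (-1) 1)} (K : Coeff φ hφ)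

/-! ### The coefficient algebra -/

/-! Two things have to be shown: every four-form is a multiple of ω, and yω = 0 forces y = 0.

Spanning. Differentiating the one-form relations gives dt² = 0, dy dt = −dt dy, and dx^i dx^j =
−A_ij dx^j dx^i up to terms with a factor dt (`dx_mul_dx`). Four-forms are therefore left
combinations of words in four dx^i and of dt times words in three dx^i (`formsOfDegree_le_words`).
Sorting the letters and discarding repetitions leaves five words. Write u_j = x^j x^{j*}; it
commutes with all x^i and dx^i, and the sphere relation becomes du_0 + du_2 + 2t dt = 0 (`dsphere`).
Substituting −du_0 − du_2 for 2t dt turns tω and the x^i ω into (aa* + bb* + t²) times a scalar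
multiple of one of the five words, hence into that multiple itself (`t_smul_vol`, `X_zero_mul_vol`
and its companions). So all five words are multiples of ω. The same relation makes da da* db db*
commute with the generators (`X_mul_areas`), which leads to centrality of ω (`X_mul_vol`).

Independence. Ω is represented on a flat model: the free module over the sphere algebra on ordered
monomials in five letters, with operators τ, θ_0, …, θ_3 that anticommute up to the factors A
(`frame`). Two corrections are needed. Weight operators ν_j, for which x^i and θ^i have weight β_ji,
enter through dx^i = θ^i + τ x^i ν_i and produce the terms ½B dt. The radial form ρ = ½ Σ x^j θ^{j*}
+ tτ is removed by θ^i ↦ θ^i − x^i ρ, τ ↦ τ − tρ (`tangent`), so that the sphere relation holds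
(`tangent_radial`). Since ρ² = 0, left multiplication by ρ makes the projection invisible, and ρ
times suitable words is ½x^i or t times the flat volume form. Thus yω = 0 gives ya = yb = ty = 0,
and y = y(aa* + bb* + t²) = 0 (`eq_zero_of_form_mul_vol`). -/

theorem deriv_add (f g : K.Fun) : K.deriv (f + g) = K.deriv f + K.deriv g :=
  Subtype.ext (map_add ddt (show K.alg from f).1 (show K.alg from g).1)

theorem deriv_mul (f g : K.Fun) : K.deriv (f * g) = f * K.deriv g + g * K.deriv f :=
  Subtype.ext (ddt.leibniz (show K.alg from f).1 (show K.alg from g).1)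

theorem deriv_algebraMap (c : ℂ) : K.deriv (algebraMap ℂ K.Fun c) = 0 :=
  Subtype.ext (ddt.map_algebraMap c)

theorem deriv_one : K.deriv 1 = 0 := by
  simpa using K.deriv_algebraMap 1

theorem deriv_zero : K.deriv 0 = 0 := by
  simpa using K.deriv_algebraMap 0

theorem deriv_t : K.deriv K.t = 1 := by
  refine Subtype.ext (Subtype.ext (funext fun x => ?_))
  change derivWithin (extend fun x => ((x : ℝ) : ℂ)) (Set.Icc (-1) 1) x = 1
  have h : HasDerivWithinAt (fun x : ℝ => (x : ℂ)) 1 (Set.Icc (-1) 1) x :=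
    Complex.ofRealCLM.hasDerivAt.hasDerivWithinAt
  exact (h.congr (fun y hy => extend_of_mem _ hy) (extend_of_mem _ x.2)).derivWithin
    (uniqueDiffOn_interval x x.2)

theorem l_mul_lbar : K.l * K.lbar = 1 := by
  refine Subtype.ext (Subtype.ext (funext fun x => ?_))
  change Complex.exp (Complex.I * ((-φ x : ℝ) : ℂ)) * Complex.exp (Complex.I * φ x) = 1
  rw [← Complex.exp_add]
  simp

/-- The index of the adjoint of a generator. -/
def conj : Fin 4 → Fin 4 := ![1, 0, 3, 2]

theorem A_mul_A (i j : Fin 4) : K.A i j * K.A j i = 1 := by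
  have h := K.l_mul_lbar
  fin_cases i <;> fin_cases j <;> simp [A, h, mul_comm K.lbar]

theorem A_self (i : Fin 4) : K.A i i = 1 := by
  fin_cases i <;> simp [A]

/-- Passing to the adjoint of a generator inverts its commutation factors, and A_ji is the inverse
of A_ij. The cancellations between x^j and x^{j*} below all come from this and its logarithmic
derivative `B_conj_right`. -/
theorem A_conj_right (i j : Fin 4) : K.A i (conj j) = K.A j i := by
  fin_cases i <;> fin_cases j <;> simp [A, conj]

theorem A_conj_left (i j : Fin 4) : K.A (conj i) j = K.A j i := by
  fin_cases i <;> fin_cases j <;> simp [A, conj]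

theorem A_conj_self (i : Fin 4) : K.A i (conj i) = 1 := by
  rw [A_conj_right, A_self]

theorem B_swap (i j : Fin 4) : K.B j i = -K.B i j := by
  have h := K.deriv_mul (K.A i j) (K.A j i)
  rw [A_mul_A, deriv_one] at h
  simp only [B, Matrix.of_apply]
  linear_combination -h

theorem B_conj_right (i j : Fin 4) : K.B i (conj j) = -K.B i j := by
  rw [← B_swap]
  simp only [B, Matrix.of_apply, A_conj_right, A_conj_left]

theorem B_conj_left (i j : Fin 4) : K.B (conj i) j = -K.B i j := by
  rw [← B_swap]
  simp only [B, Matrix.of_apply, A_conj_right, A_conj_left]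

theorem B_self (i : Fin 4) : K.B i i = 0 := by
  simp [B, A_self, deriv_one]

/-- The matrix `B / 2`. -/
noncomputable def β (i j : Fin 4) : K.Fun := (1 / 2 : ℂ) • K.B i j

theorem two_smul_β (i j : Fin 4) : (2 : ℂ) • K.β i j = K.B i j := by
  simp [β, smul_smul]

theorem β_add_β (i j : Fin 4) : K.β i j + K.β i j = K.B i j := by
  rw [← two_smul_β, two_smul]

theorem β_swap (i j : Fin 4) : K.β j i = -K.β i j := by
  rw [β, B_swap, smul_neg, β]

theorem β_conj_right (i j : Fin 4) : K.β i (conj j) = -K.β i j := by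
  rw [β, B_conj_right, smul_neg, β]

theorem β_conj_left (i j : Fin 4) : K.β (conj i) j = -K.β i j := by
  rw [β, B_conj_left, smul_neg, β]

theorem β_self (i : Fin 4) : K.β i i = 0 := by
  rw [β, B_self, smul_zero]

/-! ### The algebra of the sphere -/

instance : IsScalarTower ℂ K.Fun K.Sphere :=
  inferInstanceAs (IsScalarTower ℂ K.Fun (RingQuot K.SphereRel))

/-- The quotient map from the free algebra to the sphere algebra. -/
noncomputable def sphereMk : FreeAlgebra K.Fun (Fin 4) →ₐ[K.Fun] K.Sphere :=
  RingQuot.mkAlgHom K.Fun K.SphereRel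

theorem sphereMk_ι (i : Fin 4) : K.sphereMk (FreeAlgebra.ι K.Fun i) = K.x i := rfl

theorem sphereMk_rel {p q : FreeAlgebra K.Fun (Fin 4)} (h : K.SphereRel p q) :
    K.sphereMk p = K.sphereMk q :=
  RingQuot.mkAlgHom_rel K.Fun h

theorem x_mul_x (i j : Fin 4) : K.x i * K.x j = K.A i j • (K.x j * K.x i) := by
  simpa only [map_mul, map_smul, sphereMk_ι] using K.sphereMk_rel (SphereRel.comm i j)

theorem sphere_eq : K.x 0 * K.x 1 + K.x 2 * K.x 3 + K.fn (K.t ^ 2) = 1 := by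
  simpa only [map_add, map_mul, map_one, sphereMk_ι, AlgHom.commutes, fn] using
    K.sphereMk_rel SphereRel.sphere

theorem fn_mul (f : K.Fun) (y : K.Sphere) : K.fn f * y = f • y :=
  (Algebra.smul_def f y).symm

theorem mul_fn (f : K.Fun) (y : K.Sphere) : y * K.fn f = f • y := by
  rw [← fn_mul]
  exact (Algebra.commutes f y).symm

theorem fn_algebraMap (c : ℂ) : K.fn (algebraMap ℂ K.Fun c) = algebraMap ℂ K.Sphere c :=
  (IsScalarTower.algebraMap_apply ℂ K.Fun K.Sphere c).symm

/-- Induction on the elements of the sphere algebra. -/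
theorem sphere_induction {P : K.Sphere → Prop} (hfn : ∀ f, P (K.fn f)) (hx : ∀ i, P (K.x i))
    (hadd : ∀ y z, P y → P z → P (y + z)) (hmul : ∀ y z, P y → P z → P (y * z))
    (y : K.Sphere) : P y := by
  obtain ⟨p, rfl⟩ := RingQuot.mkAlgHom_surjective K.Fun K.SphereRel y
  change P (K.sphereMk p)
  induction p using FreeAlgebra.induction with
  | grade0 f =>
    rw [AlgHom.commutes]
    exact hfn f
  | grade1 i => exact hx i
  | mul p q hp hq =>
    rw [map_mul]
    exact hmul _ _ hp hq
  | add p q hp hq =>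
    rw [map_add]
    exact hadd _ _ hp hq

/-- The universal property of the sphere algebra. -/
noncomputable def sphereLift {C : Type*} [Ring C] [Algebra K.Fun C] (y : Fin 4 → C)
    (h : ∀ i j, y i * y j = K.A i j • (y j * y i))
    (hs : y 0 * y 1 + y 2 * y 3 + algebraMap K.Fun C (K.t ^ 2) = 1) : K.Sphere →ₐ[K.Fun] C :=
  RingQuot.liftAlgHom K.Fun ⟨FreeAlgebra.lift K.Fun y, by
    intro p q hpq
    cases hpq with
    | comm i j => simpa using h i j
    | sphere =>
      rw [map_add, AlgHom.commutes]
      simpa using hs⟩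

theorem sphereLift_x {C : Type*} [Ring C] [Algebra K.Fun C] (y : Fin 4 → C)
    (h : ∀ i j, y i * y j = K.A i j • (y j * y i))
    (hs : y 0 * y 1 + y 2 * y 3 + algebraMap K.Fun C (K.t ^ 2) = 1) (i : Fin 4) :
    K.sphereLift y h hs (K.x i) = y i :=
  (RingQuot.liftAlgHom_mkAlgHom_apply K.Fun _ _ _).trans (FreeAlgebra.lift_ι_apply y i)

end Coeff

end DynSphere

namespace DynSphere

namespace Univ

variable {A : Type*} [Ring A] [Algebra ℂ A]

/-! ### The sign automorphism and the graded Leibniz rule -/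

theorem induction {P : Univ A → Prop} (hof : ∀ x, P (of x)) (hδ : ∀ x, P (δ x))
    (hadd : ∀ v w, P v → P w → P (v + w)) (hmul : ∀ v w, P v → P w → P (v * w))
    (w : Univ A) : P w := by
  obtain ⟨p, rfl⟩ := RingQuot.mkAlgHom_surjective ℂ (UnivRel A) w
  change P (mk A p)
  induction p using FreeAlgebra.induction with
  | grade0 c =>
    rw [AlgHom.commutes, ← of_scalar]
    exact hof _
  | grade1 s => exact s.rec hof hδ
  | mul p q hp hq =>
    rw [map_mul]
    exact hmul _ _ hp hq
  | add p q hp hq =>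
    rw [map_add]
    exact hadd _ _ hp hq

theorem dMatrix_of (x : A) : dMatrix (of x) = !![of x, δ x; 0, of x] := by
  simp [dMatrix, of, lift_mk, dSymbol]

theorem dMatrix_δ (x : A) : dMatrix (δ x) = !![-δ x, 0; 0, δ x] := by
  simp [dMatrix, δ, lift_mk, dSymbol]

/-- Multiplication by `(-1)^n` in degree `n`. -/
noncomputable def sgn : Univ A →ₗ[ℂ] Univ A where
  toFun w := dMatrix w 0 0
  map_add' v w := by simp
  map_smul' c w := by simp

theorem sgn_of (x : A) : sgn (of x) = of x := by
  simp [sgn, dMatrix_of]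

theorem sgn_δ (x : A) : sgn (δ x) = -δ x := by
  simp [sgn, dMatrix_δ]

theorem dMatrix_eq (w : Univ A) : dMatrix w = !![sgn w, d w; 0, w] := by
  have h : dMatrix w 1 0 = 0 ∧ dMatrix w 1 1 = w := by
    induction w using Univ.induction with
    | hof x => simp [dMatrix_of]
    | hδ x => simp [dMatrix_δ]
    | hadd v w hv hw => simp [hv, hw]
    | hmul v w hv hw => simp [Matrix.mul_apply, hv, hw]
  ext i j
  fin_cases i <;> fin_cases j
  exacts [rfl, rfl, h.1, h.2]

theorem sgn_mul (v w : Univ A) : sgn (v * w) = sgn v * sgn w := by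
  change dMatrix (v * w) 0 0 = _
  simp [dMatrix_eq v, dMatrix_eq w]

theorem d_mul (v w : Univ A) : d (v * w) = d v * w + sgn v * d w := by
  change dMatrix (v * w) 0 1 = _
  simp [dMatrix_eq v, dMatrix_eq w, add_comm]

/-- The differential raises the degree by one, so it anticommutes with the sign. This cancels the
cross terms in d(d(vw)). -/
theorem sgn_d (w : Univ A) : sgn (d w) = -d (sgn w) := by
  induction w using Univ.induction with
  | hof x => simp [sgn_of, d_of, sgn_δ]
  | hδ x => simp [sgn_δ, d_δ]
  | hadd v w hv hw => simp [hv, hw, add_comm]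
  | hmul v w hv hw => simp [sgn_mul, d_mul, hv, hw, add_comm]

theorem d_d (w : Univ A) : d (d w) = 0 := by
  induction w using Univ.induction with
  | hof x => simp [d_of, d_δ]
  | hδ x => simp [d_δ]
  | hadd v w hv hw => simp [hv, hw]
  | hmul v w hv hw => simp [d_mul, hv, hw, sgn_d]

end Univ

namespace Coeff

variable {φ : ℝ → ℝ} {hφ : ContDiffOn ℝ ∞ φ (Set.Icc (-1) 1)} (K : Coeff φ hφ)

/-! ### The differential of `Ω(S⁴_λ)` -/

theorem proj_surjective : Function.Surjective K.proj :=
  RingQuot.mkAlgHom_surjective ℂ K.FormRel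

theorem proj_eq_zero {w : Univ K.Sphere} (hw : w ∈ K.J) : K.proj w = 0 :=
  (RingQuot.mkAlgHom_rel ℂ (FormRel.zero w hw)).trans (map_zero K.proj)

theorem proj_d_eq_zero {w : Univ K.Sphere} (hw : w ∈ K.J) : K.proj (Univ.d w) = 0 :=
  (RingQuot.mkAlgHom_rel ℂ (FormRel.d_zero w hw)).trans (map_zero K.proj)

/-- The relations are homogeneous of degree one. Hence the sign, and with it the differential,
passes to the quotient. -/
theorem sgn_of_oneFormRel {r : Univ K.Sphere} (hr : K.OneFormRel r) : Univ.sgn r = -r := by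
  cases hr <;> simp [Univ.sgn_mul, Univ.sgn_of, Univ.sgn_δ, smul_neg] <;> abel

theorem sgn_of_mem_J {w : Univ K.Sphere} (hw : w ∈ K.J) : Univ.sgn w = -w := by
  induction hw using Submodule.span_induction with
  | mem w h =>
    obtain ⟨y, z, r, hr, rfl⟩ := h
    simp [Univ.sgn_mul, Univ.sgn_of, K.sgn_of_oneFormRel hr]
  | zero => simp
  | add v w _ _ hv hw => rw [map_add, hv, hw, neg_add]
  | smul c w _ hw => rw [map_smul, hw, smul_neg]

/-- The algebra map `w ↦ (σ w, dw; 0, w)` on `Ω(S⁴_λ)`, where `σ` is multiplication by `(-1)^n`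
in degree `n`. -/
noncomputable def formMatrix : K.Forms →ₐ[ℂ] Matrix (Fin 2) (Fin 2) K.Forms :=
  RingQuot.liftAlgHom ℂ ⟨K.proj.mapMatrix.comp Univ.dMatrix, by
    intro p q hpq
    cases hpq with
    | zero w hw =>
      ext i j
      fin_cases i <;> fin_cases j <;>
        simp [Univ.dMatrix_eq, K.sgn_of_mem_J hw, K.proj_eq_zero hw, K.proj_d_eq_zero hw]
    | d_zero w hw =>
      ext i j
      fin_cases i <;> fin_cases j <;>
        simp [Univ.dMatrix_eq, Univ.sgn_d, K.sgn_of_mem_J hw, Univ.d_d, K.proj_d_eq_zero hw]⟩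

theorem formMatrix_proj (w : Univ K.Sphere) :
    K.formMatrix (K.proj w) = !![K.proj (Univ.sgn w), K.proj (Univ.d w); 0, K.proj w] := by
  refine (RingQuot.liftAlgHom_mkAlgHom_apply ℂ _ _ w).trans ?_
  ext i j
  fin_cases i <;> fin_cases j <;> simp [Univ.dMatrix_eq]

/-- The differential of `Ω(S⁴_λ)`. -/
noncomputable def D : K.Forms →ₗ[ℂ] K.Forms where
  toFun w := K.formMatrix w 0 1
  map_add' v w := by simp
  map_smul' c w := by simp

theorem D_proj (w : Univ K.Sphere) : K.D (K.proj w) = K.proj (Univ.d w) := by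
  simp [D, formMatrix_proj]

theorem D_form (y : K.Sphere) : K.D (K.form y) = K.dform y := by
  rw [form, D_proj, Univ.d_of, dform]

theorem D_dform (y : K.Sphere) : K.D (K.dform y) = 0 := by
  rw [dform, D_proj, Univ.d_δ, map_zero]

theorem D_form_mul (y : K.Sphere) (w : K.Forms) :
    K.D (K.form y * w) = K.dform y * w + K.form y * K.D w := by
  obtain ⟨w, rfl⟩ := K.proj_surjective w
  rw [form, dform, ← map_mul, D_proj, Univ.d_of_mul, D_proj, map_add, map_mul, map_mul]

theorem D_dform_mul (y : K.Sphere) (w : K.Forms) :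
    K.D (K.dform y * w) = -(K.dform y * K.D w) := by
  obtain ⟨w, rfl⟩ := K.proj_surjective w
  rw [dform, ← map_mul, D_proj, Univ.d_mul, Univ.d_δ, Univ.sgn_δ, D_proj]
  simp

/-! ### The relations in `Ω(S⁴_λ)` -/

theorem form_add (y z : K.Sphere) : K.form (y + z) = K.form y + K.form z := by
  rw [form, Univ.of_add, map_add, form, form]

theorem form_mul (y z : K.Sphere) : K.form (y * z) = K.form y * K.form z := by
  rw [form, Univ.of_mul, map_mul, form, form]

theorem form_algebraMap (c : ℂ) : K.form (algebraMap ℂ K.Sphere c) = algebraMap ℂ K.Forms c := by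
  rw [form, Univ.of_scalar, AlgHom.commutes]

theorem form_one : K.form 1 = 1 := by
  simpa using K.form_algebraMap 1

/-- The inclusion of the forms of degree zero. -/
noncomputable def formHom : K.Sphere →ₐ[ℂ] K.Forms :=
  AlgHom.ofLinearMap
    { toFun := K.form
      map_add' := K.form_add
      map_smul' := fun c y => by
        rw [Algebra.smul_def, form_mul, form_algebraMap, RingHom.id_apply, Algebra.smul_def] }
    K.form_one K.form_mul

theorem dform_add (y z : K.Sphere) : K.dform (y + z) = K.dform y + K.dform z := by
  rw [dform, Univ.δ_add, map_add, dform, dform]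

theorem dform_mul (y z : K.Sphere) :
    K.dform (y * z) = K.dform y * K.form z + K.form y * K.dform z := by
  rw [dform, Univ.δ_mul, map_add, map_mul, map_mul, dform, dform, form, form]

theorem proj_oneFormRel {r : Univ K.Sphere} (hr : K.OneFormRel r) : K.proj r = 0 := by
  refine K.proj_eq_zero (Submodule.subset_span ⟨1, 1, r, hr, ?_⟩)
  have h : (Univ.of 1 : Univ K.Sphere) = 1 := by simpa using Univ.of_scalar (A := K.Sphere) 1
  rw [h, one_mul, mul_one]

theorem dform_fn (f : K.Fun) : K.dform (K.fn f) = K.form (K.fn (K.deriv f)) * K.dt := by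
  have h := K.proj_oneFormRel (OneFormRel.chain f)
  rwa [map_sub, map_mul, sub_eq_zero] at h

theorem form_mul_dt (y : K.Sphere) : K.form y * K.dt = K.dt * K.form y := by
  have h := K.proj_oneFormRel (OneFormRel.dt_central y)
  rwa [map_sub, map_mul, map_mul, sub_eq_zero] at h

/-- Differentiate f x^i = x^i f; the two terms with df cancel because df is a multiple of the
central dt. -/
theorem fn_mul_dx (f : K.Fun) (i : Fin 4) :
    K.form (K.fn f) * K.dform (K.x i) = K.dform (K.x i) * K.form (K.fn f) := by
  have h : K.dform (K.fn f * K.x i) = K.dform (K.x i * K.fn f) := by rw [fn_mul, mul_fn]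
  rw [dform_mul, dform_mul, dform_fn, mul_assoc, ← form_mul_dt, ← mul_assoc, ← mul_assoc,
    ← form_mul, ← form_mul, fn_mul, mul_fn, add_comm] at h
  exact add_right_cancel h

/-- Centrality in the whole of Ω is what allows coefficients to act as scalars from here on. -/
theorem form_fn_mul (f : K.Fun) (w : K.Forms) : K.form (K.fn f) * w = w * K.form (K.fn f) := by
  obtain ⟨w, rfl⟩ := K.proj_surjective w
  induction w using Univ.induction with
  | hof y =>
    change _ * K.form y = K.form y * _
    rw [← form_mul, ← form_mul, fn_mul, mul_fn]
  | hδ y =>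
    change _ * K.dform y = K.dform y * _
    induction y using K.sphere_induction with
    | hfn g =>
      rw [dform_fn, ← mul_assoc, ← form_mul, fn_mul, ← mul_fn, form_mul, mul_assoc, mul_assoc,
        form_mul_dt]
    | hx i => exact K.fn_mul_dx f i
    | hadd y z hy hz => rw [dform_add, mul_add, add_mul, hy, hz]
    | hmul y z hy hz =>
      have h : ∀ u : K.Sphere, K.form (K.fn f) * K.form u = K.form u * K.form (K.fn f) := by
        intro u
        rw [← form_mul, ← form_mul, fn_mul, mul_fn]
      rw [dform_mul, mul_add, add_mul, ← mul_assoc, hy, mul_assoc, h, mul_assoc,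
        mul_assoc (K.form y), ← hz, ← mul_assoc (K.form (K.fn f)) (K.form y), h y,
        mul_assoc (K.form y)]
  | hadd v w hv hw => rw [map_add, mul_add, add_mul, hv, hw]
  | hmul v w hv hw => rw [map_mul, ← mul_assoc, hv, mul_assoc, hw, mul_assoc]

noncomputable instance : Algebra K.Fun K.Forms :=
  (K.formHom.toRingHom.comp K.fn).toAlgebra' fun f w => K.form_fn_mul f w

theorem form_fn (f : K.Fun) : K.form (K.fn f) = algebraMap K.Fun K.Forms f := rfl

instance : IsScalarTower ℂ K.Fun K.Forms :=
  IsScalarTower.of_algebraMap_eq fun c => by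
    rw [← form_fn, fn_algebraMap, form_algebraMap]

theorem form_smul (f : K.Fun) (y : K.Sphere) : K.form (f • y) = f • K.form y := by
  rw [← fn_mul, form_mul, form_fn, Algebra.smul_def]

end Coeff

end DynSphere

namespace DynSphere

namespace Coeff

variable {φ : ℝ → ℝ} {hφ : ContDiffOn ℝ ∞ φ (Set.Icc (-1) 1)} (K : Coeff φ hφ)

/-! ### Commutation rules -/

/-- The generators as forms of degree zero. -/
noncomputable abbrev X (i : Fin 4) : K.Forms := K.form (K.x i)

/-- The differentials of the generators. -/
noncomputable abbrev dx (i : Fin 4) : K.Forms := K.dform (K.x i)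

theorem deriv_A (i j : Fin 4) : K.deriv (K.A i j) = K.B i j * K.A i j := by
  simp only [B, Matrix.of_apply]
  linear_combination -K.deriv (K.A i j) * K.A_mul_A i j

theorem D_smul (f : K.Fun) (w : K.Forms) : K.D (f • w) = K.deriv f • (K.dt * w) + f • K.D w := by
  rw [Algebra.smul_def, ← form_fn, D_form_mul, dform_fn, form_fn, form_fn, Algebra.smul_def,
    Algebra.smul_def, mul_assoc]

/-- Apply the differential to d(t²) = 2t dt. -/
theorem dt_mul_dt : K.dt * K.dt = 0 := by
  have h := congrArg K.D (K.dform_fn (K.t * K.t))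
  rw [D_dform, form_fn, ← Algebra.smul_def, D_smul, D_dform, smul_zero, add_zero, deriv_mul,
    deriv_t, mul_one, deriv_add, deriv_t, ← map_one (algebraMap ℂ K.Fun), ← map_add,
    algebraMap_smul] at h
  exact (smul_eq_zero_iff_right (by norm_num : (1 + 1 : ℂ) ≠ 0)).mp h.symm

theorem dt_mul_dt_mul (w : K.Forms) : K.dt * (K.dt * w) = 0 := by
  rw [← mul_assoc, dt_mul_dt, zero_mul]

theorem dform_mul_dt (y : K.Sphere) : K.dform y * K.dt = -(K.dt * K.dform y) := by
  have h := congrArg K.D (K.form_mul_dt y)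
  rwa [D_form_mul, D_dform, mul_zero, add_zero, D_dform_mul, D_form] at h

theorem form_mul_dt_mul (y : K.Sphere) (w : K.Forms) :
    K.form y * (K.dt * w) = K.dt * (K.form y * w) := by
  rw [← mul_assoc, form_mul_dt, mul_assoc]

theorem dform_mul_dt_mul (y : K.Sphere) (w : K.Forms) :
    K.dform y * (K.dt * w) = -(K.dt * (K.dform y * w)) := by
  rw [← mul_assoc, dform_mul_dt, neg_mul, mul_assoc]

theorem X_mul_X (i j : Fin 4) : K.X i * K.X j = K.A i j • (K.X j * K.X i) := by
  rw [X, X, ← form_mul, x_mul_x, form_smul, form_mul]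

theorem X_mul_dx (i j : Fin 4) : K.X i * K.dx j =
    K.A i j • (K.dx j * K.X i) + K.β i j • (K.dt * (K.X i * K.X j)) := by
  have h := K.proj_oneFormRel (OneFormRel.x_dx i j)
  rw [map_sub, map_add, map_smul, map_mul, map_mul, map_mul, map_mul, map_mul, Univ.of_mul,
    map_mul, sub_eq_zero] at h
  refine h.trans ?_
  change K.form (K.fn _) * K.dx j * K.X i + (1 / 2 : ℂ) • (K.form (K.fn _) * K.dt * _) = _
  rw [form_fn, form_fn, mul_assoc, mul_assoc, ← Algebra.smul_def, ← Algebra.smul_def, β,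
    smul_assoc]
  rfl

/-- Behind dt the B-corrections vanish, since they carry a second dt; only the factors A remain. -/
theorem dt_mul_X_mul_dx (i j : Fin 4) (w : K.Forms) : K.dt * (K.X i * (K.dx j * w)) =
    K.A i j • (K.dt * (K.dx j * (K.X i * w))) := by
  rw [← mul_assoc (K.X i), X_mul_dx]
  simp only [add_mul, mul_add, smul_mul_assoc, mul_smul_comm, mul_assoc, dt_mul_dt_mul, smul_zero,
    add_zero]

/-- The differential of `X_mul_dx`. As A' = 2βA, differentiating the coefficient gives 2β dt x^i
dx^j, while the term β dt x^i x^j gives −β dt d(x^i x^j); their sum is the antisymmetric correction.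
-/
theorem dx_mul_dx (i j : Fin 4) : K.dx i * K.dx j = -(K.A i j • (K.dx j * K.dx i))
    + K.β i j • (K.dt * (K.X i * K.dx j - K.dx i * K.X j)) := by
  have h := congrArg K.D (K.X_mul_dx i j)
  have h2 := K.dt_mul_X_mul_dx i j 1
  rw [mul_one, mul_one] at h2
  rw [D_form_mul, D_dform, mul_zero, add_zero, map_add, D_smul, D_smul, D_dform_mul, D_dform_mul,
    D_form_mul, D_form, D_form, dt_mul_dt_mul, smul_zero, zero_add, deriv_A, mul_smul, ← h2] at h
  rw [h, ← β_add_β, mul_sub, mul_add]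
  module

theorem dt_mul_dx_mul_dx (i j : Fin 4) (w : K.Forms) : K.dt * (K.dx i * (K.dx j * w)) =
    -(K.A i j • (K.dt * (K.dx j * (K.dx i * w)))) := by
  rw [← mul_assoc (K.dx i), dx_mul_dx]
  simp only [add_mul, mul_add, smul_mul_assoc, mul_smul_comm, mul_assoc, dt_mul_dt_mul, smul_zero,
    add_zero, neg_mul, mul_neg]

theorem X_mul_dx_self (i : Fin 4) : K.X i * K.dx i = K.dx i * K.X i := by
  rw [X_mul_dx, A_self, β_self, one_smul, zero_smul, add_zero]

theorem β_conj_self (i : Fin 4) : K.β i (conj i) = 0 := by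
  rw [β_conj_right, β_self, neg_zero]

theorem conj_conj (i : Fin 4) : conj (conj i) = i := by
  fin_cases i <;> rfl

theorem X_mul_dx_conj (i : Fin 4) : K.X i * K.dx (conj i) = K.dx (conj i) * K.X i := by
  rw [X_mul_dx, A_conj_self, β_conj_self, one_smul, zero_smul, add_zero]

theorem X_conj_mul_dx (i : Fin 4) : K.X (conj i) * K.dx i = K.dx i * K.X (conj i) := by
  simpa only [conj_conj] using K.X_mul_dx_conj (conj i)

theorem X_mul_X_conj (i : Fin 4) : K.X i * K.X (conj i) = K.X (conj i) * K.X i := by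
  rw [X_mul_X, A_conj_self, one_smul]

theorem dx_mul_dx_self (i : Fin 4) : K.dx i * K.dx i = 0 := by
  have h := K.dx_mul_dx i i
  rw [A_self, β_self, one_smul, zero_smul, add_zero, eq_neg_iff_add_eq_zero, ← two_smul ℂ] at h
  exact (smul_eq_zero_iff_right two_ne_zero).mp h

theorem dx_mul_dx_self_mul (i : Fin 4) (w : K.Forms) : K.dx i * (K.dx i * w) = 0 := by
  rw [← mul_assoc, dx_mul_dx_self, zero_mul]

theorem dx_mul_dx_conj (i : Fin 4) : K.dx i * K.dx (conj i) = -(K.dx (conj i) * K.dx i) := by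
  rw [dx_mul_dx, A_conj_self, β_conj_self, one_smul, zero_smul, add_zero]

/-! ### The invariant forms -/

/-- The differential of `x^j x^{j*}`. -/
noncomputable def du (j : Fin 4) : K.Forms := K.dform (K.x j * K.x (conj j))

/-- The two-form `dx^j dx^{j*}`. -/
noncomputable def area (j : Fin 4) : K.Forms := K.dx j * K.dx (conj j)

theorem du_eq (j : Fin 4) : K.du j = K.X j * K.dx (conj j) + K.X (conj j) * K.dx j := by
  rw [du, dform_mul, X_conj_mul_dx, add_comm]

theorem x_mul_norm (i j : Fin 4) :
    K.x i * (K.x j * K.x (conj j)) = K.x j * K.x (conj j) * K.x i := by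
  rw [← mul_assoc, x_mul_x, smul_mul_assoc, mul_assoc, K.x_mul_x i (conj j), mul_smul_comm,
    smul_smul, A_conj_right, A_mul_A, one_smul, mul_assoc]

/-- The factors A contributed by x^j and x^{j*} are mutually inverse and the corrections β opposite,
so x^j x^{j*} commutes with all one-forms dx^i. The commutation rules of `du` follow by the Leibniz
rule. -/
theorem norm_mul_dx (i j : Fin 4) : K.form (K.x j * K.x (conj j)) * K.dx i =
    K.dx i * K.form (K.x j * K.x (conj j)) := by
  have h := K.X_mul_X i (conj j)
  rw [form_mul, mul_assoc, X_mul_dx, mul_add, mul_smul_comm, mul_smul_comm, ← mul_assoc, X_mul_dx,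
    form_mul_dt_mul, A_conj_left, β_conj_left, β_swap, add_mul, smul_add, smul_mul_assoc,
    smul_mul_assoc, smul_smul, A_mul_A, one_smul, mul_assoc (K.dt), mul_assoc (K.X j) (K.X i), h,
    A_conj_right, mul_smul_comm, mul_smul_comm, mul_assoc]
  rw [smul_comm (-K.β i j), smul_smul (K.A i j), A_mul_A, one_smul]
  module

theorem X_mul_du (i j : Fin 4) : K.X i * K.du j = K.du j * K.X i := by
  have h := congrArg K.dform (K.x_mul_norm i j)
  rw [K.dform_mul (K.x i), K.dform_mul (K.x j * _), norm_mul_dx, add_comm] at h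
  exact add_right_cancel h

theorem dx_mul_du (i j : Fin 4) : K.dx i * K.du j = -(K.du j * K.dx i) := by
  have h := congrArg K.D (K.norm_mul_dx i j)
  rw [D_form_mul, D_dform, mul_zero, add_zero, D_dform_mul, D_form] at h
  rw [du, h, neg_neg]

theorem X_mul_du_mul (i j : Fin 4) (w : K.Forms) :
    K.X i * (K.du j * w) = K.du j * (K.X i * w) := by
  rw [← mul_assoc, X_mul_du, mul_assoc]

theorem dx_mul_du_mul (i j : Fin 4) (w : K.Forms) :
    K.dx i * (K.du j * w) = -(K.du j * (K.dx i * w)) := by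
  rw [← mul_assoc, dx_mul_du, neg_mul, mul_assoc]

theorem dx_mul_area (j : Fin 4) : K.dx j * K.area j = 0 := by
  rw [area, dx_mul_dx_self_mul]

theorem dx_conj_mul_area (j : Fin 4) : K.dx (conj j) * K.area j = 0 := by
  rw [area, dx_mul_dx_conj, mul_neg, dx_mul_dx_self_mul, neg_zero]

theorem du_mul_area (j : Fin 4) : K.du j * K.area j = 0 := by
  rw [du_eq, add_mul, mul_assoc, mul_assoc, dx_mul_area, dx_conj_mul_area, mul_zero, mul_zero,
    add_zero]

theorem area_mul_du (i j : Fin 4) : K.area i * K.du j = K.du j * K.area i := by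
  rw [area, mul_assoc, dx_mul_du, mul_neg, dx_mul_du_mul, neg_neg]

/-- The two letters contribute β and −β, and dt changes sign on passing dx^j; the two corrections
therefore add up to the Leibniz expansion of du_j. -/
theorem X_mul_area (i j : Fin 4) : K.X i * K.area j =
    K.area j * K.X i + K.β i j • (K.dt * (K.X i * K.du j)) := by
  have h := K.dt_mul_X_mul_dx i j (K.X (conj j))
  rw [area, ← mul_assoc, X_mul_dx, add_mul, smul_mul_assoc, smul_mul_assoc, mul_assoc, X_mul_dx,
    mul_add, mul_smul_comm, mul_smul_comm, dform_mul_dt_mul, A_conj_right, β_conj_right, smul_add,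
    smul_smul, A_mul_A, one_smul, smul_comm (K.A i j), smul_neg (K.A i j), ← h, du, dform_mul]
  simp only [mul_assoc, mul_add, smul_add]
  module

theorem dt_mul_X_mul_area (i j : Fin 4) (w : K.Forms) :
    K.dt * (K.X i * (K.area j * w)) = K.dt * (K.area j * (K.X i * w)) := by
  rw [← mul_assoc (K.X i), X_mul_area]
  simp only [add_mul, mul_add, smul_mul_assoc, mul_smul_comm, mul_assoc, dt_mul_dt_mul, smul_zero,
    add_zero]

theorem X_mul_area_self (j : Fin 4) : K.X j * K.area j = K.area j * K.X j := by
  rw [X_mul_area, β_self, zero_smul, add_zero]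

theorem X_conj_mul_area (j : Fin 4) : K.X (conj j) * K.area j = K.area j * K.X (conj j) := by
  rw [X_mul_area, β_swap, β_conj_self, neg_zero, zero_smul, add_zero]

theorem area_mul_dt (j : Fin 4) : K.area j * K.dt = K.dt * K.area j := by
  rw [area, mul_assoc, dform_mul_dt, mul_neg, dform_mul_dt_mul, neg_neg]

theorem area_mul_dt_mul (j : Fin 4) (w : K.Forms) :
    K.area j * (K.dt * w) = K.dt * (K.area j * w) := by
  rw [← mul_assoc, area_mul_dt, mul_assoc]

theorem area_mul_du_mul (i j : Fin 4) (w : K.Forms) :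
    K.area i * (K.du j * w) = K.du j * (K.area i * w) := by
  rw [← mul_assoc, area_mul_du, mul_assoc]

theorem dsphere : K.du 0 + K.du 2 + (2 : ℂ) • (K.t • K.dt) = 0 := by
  have h := K.proj_oneFormRel OneFormRel.sphere
  rw [map_add, map_add, map_add, map_add, map_smul, map_mul, map_mul, map_mul, map_mul,
    map_mul] at h
  rw [du_eq, du_eq, ← add_assoc, Algebra.smul_def]
  exact h

theorem dt_mul_du (w : K.Forms) : K.dt * (K.du 0 * w) = -(K.dt * (K.du 2 * w)) := by
  have h := congrArg (fun z => K.dt * z * w) K.dsphere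
  simp only [mul_add, mul_smul_comm, dt_mul_dt, smul_zero, add_zero, add_mul, mul_zero, zero_mul,
    mul_assoc] at h
  exact eq_neg_of_add_eq_zero_left h

end Coeff

end DynSphere

namespace DynSphere

namespace Coeff

variable {φ : ℝ → ℝ} {hφ : ContDiffOn ℝ ∞ φ (Set.Icc (-1) 1)} (K : Coeff φ hφ)

/-! ### The products of `ω` with the generators -/

theorem du_mul_dx (j : Fin 4) : K.du j * K.dx j = -(K.X j * K.area j) := by
  rw [du_eq, add_mul, mul_assoc, mul_assoc, dx_mul_dx_self, mul_zero, add_zero, area,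
    dx_mul_dx_conj, mul_neg, neg_neg]

theorem du_mul_dx_conj (j : Fin 4) : K.du j * K.dx (conj j) = K.X (conj j) * K.area j := by
  rw [du_eq, add_mul, mul_assoc, mul_assoc, dx_mul_dx_self, mul_zero, zero_add, area]

/-- The substitution behind all product formulas: du_j annihilates `area j` and turns dx^j or
dx^{j*} into a generator times `area j`. -/
theorem two_smul_t_dt (w : K.Forms) :
    (2 : ℂ) • (K.t • (K.dt * w)) = -(K.du 0 * w) - K.du 2 * w := by
  have h := congrArg (fun z => z * w) K.dsphere
  simp only [add_mul, smul_mul_assoc, zero_mul] at h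
  rw [← sub_eq_zero, ← h]
  abel

/-- Behind dt the sphere relation exchanges du_0 with −du_2, and du_2 annihilates dx^2 dx^3. -/
theorem dt_du_area_two (w : K.Forms) : K.dt * (K.du 0 * (K.area 2 * w)) = 0 := by
  rw [dt_mul_du, ← mul_assoc (K.du 2), du_mul_area, zero_mul, mul_zero, neg_zero]

theorem dt_du_area_zero (w : K.Forms) : K.dt * (K.du 2 * (K.area 0 * w)) = 0 := by
  rw [← neg_eq_zero, ← dt_mul_du, ← mul_assoc (K.du 0), du_mul_area, zero_mul, mul_zero]

/-- Each area commutes with x^i up to a term dt x^i du_j, and such a term dies against the other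
area by the sphere relation. -/
theorem X_mul_areas (i : Fin 4) :
    K.X i * (K.area 0 * K.area 2) = K.area 0 * K.area 2 * K.X i := by
  have h1 := K.dt_du_area_two (1 : K.Forms)
  have h2 := K.dt_du_area_zero (K.X i)
  rw [mul_one] at h1
  rw [← mul_assoc, X_mul_area, add_mul, mul_assoc, X_mul_area, mul_add, smul_mul_assoc,
    mul_smul_comm, area_mul_dt_mul, X_mul_du, area_mul_du_mul, h2, mul_assoc, mul_assoc,
    mul_assoc, X_mul_du_mul, dt_mul_du, ← X_mul_du_mul, du_mul_area]
  simp

theorem area_zero : K.area 0 = K.dx 0 * K.dx 1 := rfl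

theorem area_two : K.area 2 = K.dx 2 * K.dx 3 := rfl

theorem four_smul_vol : (4 : ℂ) • K.vol = K.t • (K.area 0 * K.area 2)
    - (2 : ℂ) • (K.dt * (K.X 0 * (K.dx 1 * K.area 2)))
    + (2 : ℂ) • (K.dt * (K.area 0 * (K.dx 2 * K.X 3))) := by
  rw [vol, smul_smul, (by norm_num : (4 : ℂ) * (1 / 4) = 1), one_smul, ← form_mul_dt_mul,
    Algebra.smul_def K.t, ← form_fn, area_zero, area_two]
  simp only [mul_assoc]

theorem norm_eq_one (w : K.Forms) : K.X 0 * (K.X 1 * w) + K.X 2 * (K.X 3 * w)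
    + K.t • (K.t • w) = w := by
  have h := congrArg (fun y => K.form y * w) K.sphere_eq
  simp only [form_add, form_mul, form_one, one_mul, add_mul, form_fn, mul_assoc] at h
  rw [smul_smul, ← sq, Algebra.smul_def]
  exact h

theorem du_zero_area (w : K.Forms) : K.du 0 * (K.area 0 * w) = 0 := by
  rw [← mul_assoc, du_mul_area, zero_mul]

theorem du_zero_dx_zero (w : K.Forms) : K.du 0 * (K.dx 0 * w) = -(K.X 0 * (K.area 0 * w)) := by
  rw [← mul_assoc, du_mul_dx, neg_mul, mul_assoc]

theorem du_zero_dx_one (w : K.Forms) : K.du 0 * (K.dx 1 * w) = K.X 1 * (K.area 0 * w) := by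
  rw [← mul_assoc, ← mul_assoc]
  exact congrArg (· * w) (K.du_mul_dx_conj 0)

theorem du_two_dx_two (w : K.Forms) : K.du 2 * (K.dx 2 * w) = -(K.X 2 * (K.area 2 * w)) := by
  rw [← mul_assoc, du_mul_dx, neg_mul, mul_assoc]

theorem X_two_area_two (w : K.Forms) : K.X 2 * (K.area 2 * w) = K.area 2 * (K.X 2 * w) := by
  rw [← mul_assoc, X_mul_area_self, mul_assoc]

theorem du_mul_dx_mul (i j : Fin 4) (w : K.Forms) :
    K.du j * (K.dx i * w) = -(K.dx i * (K.du j * w)) := by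
  rw [dx_mul_du_mul, neg_neg]

/-- In the last two terms of 4tω replace 2t dt by −du_0 − du_2. One of the two summands vanishes
each time, and the other gives aa* or bb* times da da* db db*; the first term supplies t². -/
theorem t_smul_vol : (4 : ℂ) • (K.t • K.vol) = K.area 0 * K.area 2 := by
  have h := K.norm_eq_one (K.area 0 * K.area 2)
  have h1 : K.du 2 * (K.area 0 * (K.dx 2 * K.X 3)) =
      -(K.X 2 * (K.X 3 * (K.area 0 * K.area 2))) := by
    rw [← area_mul_du_mul, du_two_dx_two, X_two_area_two, X_mul_areas, ← mul_assoc (K.X 2),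
      X_mul_areas]
    simp only [mul_assoc, mul_neg]
  rw [smul_comm, four_smul_vol, smul_add, smul_sub, smul_comm K.t (2 : ℂ), smul_comm K.t (2 : ℂ),
    two_smul_t_dt, two_smul_t_dt, ← X_mul_du_mul, ← X_mul_du_mul, du_zero_dx_one,
    du_mul_dx_mul, du_mul_area, du_zero_area, h1]
  conv_rhs => rw [← h]
  simp only [mul_zero, neg_zero]
  abel

theorem X_zero_mul_areas : K.X 0 * (K.area 0 * K.area 2) =
    (2 : ℂ) • (K.t • (K.dt * (K.dx 0 * K.area 2))) := by
  rw [two_smul_t_dt, du_zero_dx_zero, du_mul_dx_mul, du_mul_area]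
  simp

theorem X_one_mul_areas : K.X 1 * (K.area 0 * K.area 2) =
    -((2 : ℂ) • (K.t • (K.dt * (K.dx 1 * K.area 2)))) := by
  rw [two_smul_t_dt, du_zero_dx_one, du_mul_dx_mul, du_mul_area]
  simp

theorem X_two_mul_areas : K.X 2 * (K.area 0 * K.area 2) =
    (2 : ℂ) • (K.t • (K.dt * (K.area 0 * K.dx 2))) := by
  rw [two_smul_t_dt, du_zero_area, ← area_mul_du_mul, du_mul_dx, X_mul_area_self, X_mul_areas]
  simp [mul_assoc]

theorem X_three_mul_areas : K.X 3 * (K.area 0 * K.area 2) =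
    -((2 : ℂ) • (K.t • (K.dt * (K.area 0 * K.dx 3)))) := by
  have h : K.du 2 * K.dx 3 = K.area 2 * K.X 3 :=
    (K.du_mul_dx_conj 2).trans (K.X_conj_mul_area 2)
  rw [two_smul_t_dt, du_zero_area, ← area_mul_du_mul, h, X_mul_areas]
  simp [mul_assoc]

theorem norm_mul_dx_mul (j i : Fin 4) (w : K.Forms) :
    K.dx i * (K.X j * (K.X (conj j) * w)) = K.X j * (K.X (conj j) * (K.dx i * w)) := by
  have h := congrArg (· * w) (K.norm_mul_dx i j)
  simpa only [form_mul, mul_assoc] using h.symm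

theorem X_zero_mul_dx_one (w : K.Forms) :
    K.X 0 * (K.dx 1 * w) = K.du 0 * w - K.X 1 * (K.dx 0 * w) := by
  have h : K.du 0 = K.X 0 * K.dx 1 + K.X 1 * K.dx 0 := K.du_eq 0
  rw [h, add_mul, mul_assoc, mul_assoc, add_sub_cancel_right]

theorem dx_zero_mul_X_one (w : K.Forms) : K.dx 0 * (K.X 1 * w) = K.X 1 * (K.dx 0 * w) := by
  rw [← mul_assoc, ← mul_assoc]
  exact congrArg (· * w) (K.X_conj_mul_dx 0).symm

theorem dx_zero_mul_X_zero (w : K.Forms) : K.dx 0 * (K.X 0 * w) = K.X 0 * (K.dx 0 * w) := by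
  rw [← mul_assoc, ← X_mul_dx_self, mul_assoc]

theorem norm_mul_area_mul (j i : Fin 4) (w : K.Forms) :
    K.area i * (K.X j * (K.X (conj j) * w)) = K.X j * (K.X (conj j) * (K.area i * w)) := by
  rw [area, mul_assoc, mul_assoc, norm_mul_dx_mul, norm_mul_dx_mul]

theorem dt_X_du_mul (i : Fin 4) (w : K.Forms) :
    K.dt * (K.X i * (K.du 0 * w)) = -(K.dt * (K.X i * (K.du 2 * w))) := by
  rw [X_mul_du_mul, dt_mul_du, X_mul_du_mul]

theorem dt_dx_du_mul (i : Fin 4) (w : K.Forms) :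
    K.dt * (K.dx i * (K.du 0 * w)) = -(K.dt * (K.dx i * (K.du 2 * w))) := by
  rw [dx_mul_du_mul, mul_neg, dt_mul_du, dx_mul_du_mul, mul_neg]

theorem X_two_area_two_X_three :
    K.X 2 * (K.area 2 * K.X 3) = K.X 2 * (K.X 3 * K.area 2) :=
  congrArg (K.X 2 * ·) (K.X_conj_mul_area 2).symm

/-- The three terms of 4aω become t², aa* and bb* times 2 dt da db db*. For the last two, a da* is
rewritten as du_0 − a* da, and behind dt the form du_0 becomes −du_2, which db db* kills or db
absorbs. -/
theorem X_zero_mul_vol : (4 : ℂ) • (K.X 0 * K.vol) =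
    (2 : ℂ) • (K.dt * (K.dx 0 * K.area 2)) := by
  have h := K.norm_eq_one (K.dt * (K.dx 0 * K.area 2))
  have hn : ∀ w, K.dx 0 * (K.X 2 * (K.X 3 * w)) = K.X 2 * (K.X 3 * (K.dx 0 * w)) :=
    K.norm_mul_dx_mul 2 0
  have h1 : K.dt * (K.X 0 * (K.X 0 * (K.dx 1 * K.area 2))) =
      -(K.X 0 * (K.X 1 * (K.dt * (K.dx 0 * K.area 2)))) := by
    rw [X_zero_mul_dx_one, mul_sub, mul_sub, dt_X_du_mul, du_mul_area, form_mul_dt_mul,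
      form_mul_dt_mul]
    simp
  have h2 : K.dt * (K.X 0 * (K.area 0 * (K.dx 2 * K.X 3))) =
      K.X 2 * (K.X 3 * (K.dt * (K.dx 0 * K.area 2))) := by
    rw [area_zero, mul_assoc, ← dx_zero_mul_X_zero, X_zero_mul_dx_one, mul_sub, mul_sub,
      dx_zero_mul_X_one, dx_mul_dx_self_mul, dt_dx_du_mul, du_two_dx_two, mul_neg, mul_neg,
      X_two_area_two_X_three, hn, form_mul_dt_mul, form_mul_dt_mul]
    simp
  rw [← mul_smul_comm, four_smul_vol, mul_add, mul_sub, mul_smul_comm, mul_smul_comm,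
    mul_smul_comm, X_zero_mul_areas, form_mul_dt_mul, form_mul_dt_mul, h1, h2]
  conv_rhs => rw [← h]
  simp only [smul_add, smul_neg]
  rw [smul_comm K.t (2 : ℂ)]
  abel

theorem X_zero_mul_X_one (w : K.Forms) : K.X 1 * (K.X 0 * w) = K.X 0 * (K.X 1 * w) := by
  rw [← mul_assoc, ← mul_assoc]
  exact congrArg (· * w) (K.X_mul_X_conj 0).symm

theorem X_one_mul_vol : (4 : ℂ) • (K.X 1 * K.vol) =
    -((2 : ℂ) • (K.dt * (K.dx 1 * K.area 2))) := by
  have h := K.norm_eq_one (K.dt * (K.dx 1 * K.area 2))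
  have hn : ∀ w, K.dx 1 * (K.X 2 * (K.X 3 * w)) = K.X 2 * (K.X 3 * (K.dx 1 * w)) :=
    K.norm_mul_dx_mul 2 1
  have hu : ∀ w, K.X 1 * (K.dx 0 * w) = K.du 0 * w - K.X 0 * (K.dx 1 * w) := fun w => by
    rw [X_zero_mul_dx_one, sub_sub_cancel]
  have hc : ∀ w, K.X 0 * (K.dx 1 * w) = K.dx 1 * (K.X 0 * w) := fun w => by
    rw [← mul_assoc, ← mul_assoc]
    exact congrArg (· * w) (K.X_mul_dx_conj 0)
  have h1 : K.dt * (K.X 1 * (K.X 0 * (K.dx 1 * K.area 2))) =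
      K.X 0 * (K.X 1 * (K.dt * (K.dx 1 * K.area 2))) := by
    rw [X_zero_mul_X_one, form_mul_dt_mul, form_mul_dt_mul]
  have h2 : K.dt * (K.X 1 * (K.area 0 * (K.dx 2 * K.X 3))) =
      -(K.X 2 * (K.X 3 * (K.dt * (K.dx 1 * K.area 2)))) := by
    rw [area_zero, mul_assoc, hu, dx_mul_dx_self_mul, mul_zero, sub_zero, du_mul_dx_mul, mul_neg,
      dt_dx_du_mul, du_two_dx_two, mul_neg, mul_neg, neg_neg,
      X_two_area_two_X_three, hn, form_mul_dt_mul, form_mul_dt_mul]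
  rw [← mul_smul_comm, four_smul_vol, mul_add, mul_sub, mul_smul_comm, mul_smul_comm,
    mul_smul_comm, X_one_mul_areas, form_mul_dt_mul, form_mul_dt_mul, h1, h2]
  conv_rhs => rw [← h]
  simp only [smul_add, smul_neg]
  rw [smul_comm K.t (2 : ℂ)]
  abel

/-- With the generator on the right it meets the factor b* of ω directly, and bb* can be pulled to
the front because it commutes with every dx^i. -/
theorem vol_mul_X_two : (4 : ℂ) • (K.vol * K.X 2) =
    (2 : ℂ) • (K.dt * (K.area 0 * K.dx 2)) := by
  have h := K.norm_eq_one (K.dt * (K.area 0 * K.dx 2))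
  have hn : ∀ w, K.area 0 * (K.X 2 * (K.X 3 * w)) = K.X 2 * (K.X 3 * (K.area 0 * w)) :=
    K.norm_mul_area_mul 2 0
  have hd : K.dx 2 * (K.X 3 * K.X 2) = K.X 2 * (K.X 3 * K.dx 2) := by
    have h := K.norm_mul_dx_mul 2 2 1
    have hc : K.X 3 * K.X 2 = K.X 2 * K.X 3 := (K.X_mul_X_conj 2).symm
    rw [mul_one, mul_one] at h
    rw [hc]
    exact h
  have h1 : K.dt * (K.X 0 * (K.dx 1 * (K.area 2 * K.X 2))) =
      -(K.X 0 * (K.X 1 * (K.dt * (K.area 0 * K.dx 2)))) := by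
    rw [← X_mul_area_self, ← neg_neg (K.X 2 * _), ← du_mul_dx, mul_neg, mul_neg, mul_neg,
      dx_mul_du_mul, mul_neg, mul_neg, neg_neg, ← neg_neg (K.dt * _), ← dt_X_du_mul,
      du_zero_dx_one, form_mul_dt_mul, form_mul_dt_mul]
  have h2 : K.dt * (K.area 0 * (K.dx 2 * (K.X 3 * K.X 2))) =
      K.X 2 * (K.X 3 * (K.dt * (K.area 0 * K.dx 2))) := by
    rw [hd, hn, form_mul_dt_mul, form_mul_dt_mul]
  rw [← smul_mul_assoc, four_smul_vol, add_mul, sub_mul, smul_mul_assoc, smul_mul_assoc,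
    smul_mul_assoc, ← X_mul_areas, X_two_mul_areas]
  simp only [mul_assoc]
  rw [h1, h2]
  conv_rhs => rw [← h]
  simp only [smul_add, smul_neg]
  rw [smul_comm K.t (2 : ℂ)]
  abel

theorem vol_mul_X_three : (4 : ℂ) • (K.vol * K.X 3) =
    -((2 : ℂ) • (K.dt * (K.area 0 * K.dx 3))) := by
  have h := K.norm_eq_one (K.dt * (K.area 0 * K.dx 3))
  have hn : ∀ w, K.area 0 * (K.X 2 * (K.X 3 * w)) = K.X 2 * (K.X 3 * (K.area 0 * w)) :=
    K.norm_mul_area_mul 2 0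
  have hd : K.dx 2 * (K.X 3 * K.X 3) = K.du 2 * K.X 3 - K.X 2 * (K.X 3 * K.dx 3) := by
    have h1 : K.X 3 * K.dx 2 = K.dx 2 * K.X 3 := K.X_conj_mul_dx 2
    have h2 : K.du 2 = K.X 2 * K.dx 3 + K.X 3 * K.dx 2 := K.du_eq 2
    rw [h2, ← mul_assoc, ← h1, add_mul, mul_assoc (K.X 2), ← X_mul_dx_self,
      add_sub_cancel_left]
  have h1 : K.dt * (K.X 0 * (K.dx 1 * (K.area 2 * K.X 3))) =
      K.X 0 * (K.X 1 * (K.dt * (K.area 0 * K.dx 3))) := by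
    have h3 : K.area 2 * K.X 3 = K.du 2 * K.dx 3 :=
      (K.X_conj_mul_area 2).symm.trans (K.du_mul_dx_conj 2).symm
    rw [h3, dx_mul_du_mul, mul_neg, mul_neg, ← dt_X_du_mul, du_zero_dx_one, form_mul_dt_mul,
      form_mul_dt_mul]
  have h2 : K.dt * (K.area 0 * (K.dx 2 * (K.X 3 * K.X 3))) =
      -(K.X 2 * (K.X 3 * (K.dt * (K.area 0 * K.dx 3)))) := by
    rw [hd, mul_sub, mul_sub, hn, area_mul_du_mul, dt_du_area_zero, zero_sub, form_mul_dt_mul,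
      form_mul_dt_mul]
  rw [← smul_mul_assoc, four_smul_vol, add_mul, sub_mul, smul_mul_assoc, smul_mul_assoc,
    smul_mul_assoc, ← X_mul_areas, X_three_mul_areas]
  simp only [mul_assoc]
  rw [h1, h2]
  conv_rhs => rw [← h]
  simp only [smul_add, smul_neg]
  rw [smul_comm K.t (2 : ℂ)]
  abel

/-! ### Centrality of `ω` -/

/-- Behind dt only the factors A count, and those of x^0 and dx^1 are inverse to each other because
x^1 is the adjoint of x^0. -/
theorem X_mul_dx_one_area (i : Fin 4) : K.dt * (K.X i * (K.X 0 * (K.dx 1 * K.area 2))) =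
    K.dt * (K.X 0 * (K.dx 1 * (K.area 2 * K.X i))) := by
  have h := K.dt_mul_X_mul_area i 2 1
  rw [mul_one, mul_one] at h
  have hA : K.A i 0 * K.A i 1 = 1 := by
    rw [← K.A_mul_A i 0]
    exact congrArg _ (K.A_conj_right i 0)
  rw [← mul_assoc (K.X i), X_mul_X, smul_mul_assoc, mul_smul_comm, mul_assoc, ← form_mul_dt_mul,
    dt_mul_X_mul_dx, mul_smul_comm, ← neg_neg (K.dt * (K.dx 1 * _)), ← dform_mul_dt_mul, h,
    dform_mul_dt_mul, neg_neg, smul_smul, hA, one_smul, form_mul_dt_mul]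

theorem X_mul_area_dx_two (i : Fin 4) : K.dt * (K.X i * (K.area 0 * (K.dx 2 * K.X 3))) =
    K.dt * (K.area 0 * (K.dx 2 * (K.X 3 * K.X i))) := by
  have hA : K.A i 2 * K.A i 3 = 1 := by
    rw [← K.A_mul_A i 2]
    exact congrArg _ (K.A_conj_right i 2)
  rw [dt_mul_X_mul_area, ← area_mul_dt_mul, dt_mul_X_mul_dx, K.X_mul_X i 3]
  simp only [mul_smul_comm]
  rw [smul_smul, hA, one_smul, area_mul_dt_mul]

theorem X_mul_vol (i : Fin 4) : K.X i * K.vol = K.vol * K.X i := by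
  have h : (4 : ℂ) • (K.X i * K.vol) = (4 : ℂ) • (K.vol * K.X i) := by
    rw [← mul_smul_comm, ← smul_mul_assoc, four_smul_vol, mul_add, mul_sub, add_mul, sub_mul,
      mul_smul_comm, mul_smul_comm, mul_smul_comm, form_mul_dt_mul, form_mul_dt_mul,
      X_mul_dx_one_area, X_mul_area_dx_two, X_mul_areas]
    simp only [smul_mul_assoc, mul_assoc]
  exact smul_right_injective _ (by norm_num : (4 : ℂ) ≠ 0) h

theorem form_mul_vol (y : K.Sphere) : K.form y * K.vol = K.vol * K.form y := by
  induction y using K.sphere_induction with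
  | hfn f => exact K.form_fn_mul f _
  | hx i => exact K.X_mul_vol i
  | hadd y z hy hz => rw [form_add, add_mul, mul_add, hy, hz]
  | hmul y z hy hz => rw [form_mul, mul_assoc, hz, ← mul_assoc, hy, mul_assoc]

end Coeff

end DynSphere

namespace DynSphere

/-! ### Words in four letters up to adjacent transpositions -/

theorem exists_perm_of_length_four (l : List (Fin 4)) (hl : l.length = 4) :
    (∃ i q, l.Perm (i :: i :: q)) ∨ l.Perm [0, 1, 2, 3] := by
  by_cases h : l.Nodup
  · right
    have h1 : l.toFinset = Finset.univ := by
      rw [← Finset.card_eq_iff_eq_univ, List.toFinset_card_of_nodup h, hl, Fintype.card_fin]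
    exact List.perm_of_nodup_nodup_toFinset_eq h (List.nodup_finRange 4) (by rw [h1]; rfl)
  · left
    obtain ⟨i, hi⟩ := List.exists_duplicate_iff_not_nodup.mpr h
    obtain ⟨q, hq⟩ := (List.duplicate_iff_sublist.mp hi).exists_perm_append
    exact ⟨i, q, hq⟩

theorem exists_perm_of_length_three (l : List (Fin 4)) (hl : l.length = 3) :
    (∃ i q, l.Perm (i :: i :: q)) ∨ ∃ k, l.Perm ((List.finRange 4).erase k) := by
  by_cases h : l.Nodup
  · right
    obtain ⟨k, hk⟩ : ∃ k, k ∉ l := by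
      by_contra! hc
      have h1 : l.toFinset = Finset.univ := by
        ext k
        simp [hc k]
      have h2 := List.toFinset_card_of_nodup h
      rw [h1, hl] at h2
      simp at h2
    refine ⟨k, List.perm_of_nodup_nodup_toFinset_eq h ((List.nodup_finRange 4).erase k) ?_⟩
    refine Finset.eq_of_subset_of_card_le (fun i hi => ?_) ?_
    · rw [List.mem_toFinset] at hi ⊢
      exact (List.mem_erase_of_ne (by rintro rfl; exact hk hi)).mpr (List.mem_finRange i)
    · rw [List.toFinset_card_of_nodup h, hl,
        List.toFinset_card_of_nodup ((List.nodup_finRange 4).erase k),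
        List.length_erase_of_mem (List.mem_finRange k), List.length_finRange]
  · left
    obtain ⟨i, hi⟩ := List.exists_duplicate_iff_not_nodup.mpr h
    obtain ⟨q, hq⟩ := (List.duplicate_iff_sublist.mp hi).exists_perm_append
    exact ⟨i, q, hq⟩

/-- Induction on the permutation with an arbitrary prefix, so that a swap below a common head is
again a swap inside a word. The total length stays fixed because the swap hypothesis is only
available in one degree. -/
theorem of_perm_of_swap {α : Type*} {P : List α → Prop} {n : ℕ}
    (hP : ∀ p i j q, p.length + (q.length + 2) = n → P (p ++ j :: i :: q) → P (p ++ i :: j :: q))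
    {l l' : List α} (h : l.Perm l') (hl : l.length = n) (hl' : P l') : P l := by
  suffices H : ∀ p : List α, p.length + l.length = n → P (p ++ l') → P (p ++ l) from
    H [] (by simpa using hl) hl'
  clear hl hl'
  induction h with
  | nil => exact fun _ _ h => h
  | cons a _ ih =>
    intro p hp h
    have := ih (p ++ [a]) (by simp at hp ⊢; omega) (by simpa using h)
    simpa using this
  | swap a b q =>
    exact fun p hp h => hP p b a q (by simpa [add_assoc] using hp) h
  | trans h1 _ ih1 ih2 =>
    exact fun p hp h => ih1 p hp (ih2 p (by rw [← h1.length_eq]; exact hp) h)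

namespace Coeff

variable {φ : ℝ → ℝ} {hφ : ContDiffOn ℝ ∞ φ (Set.Icc (-1) 1)} (K : Coeff φ hφ)

/-! ### The four-forms are the multiples of `ω` -/

theorem form_zero : K.form 0 = 0 := map_zero K.formHom

theorem form_neg (y : K.Sphere) : K.form (-y) = -K.form y := map_neg K.formHom y

/-- The multiples of `ω`. -/
noncomputable def volMultiples : Submodule ℂ K.Forms :=
  LinearMap.range ((LinearMap.mulRight ℂ K.vol).comp K.formHom.toLinearMap)

theorem form_mul_mem_volMultiples (z : K.Sphere) {w : K.Forms} (hw : w ∈ K.volMultiples) :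
    K.form z * w ∈ K.volMultiples := by
  obtain ⟨y, rfl⟩ := hw
  exact ⟨z * y, (congrArg (· * K.vol) (K.form_mul z y)).trans (mul_assoc _ _ _)⟩

theorem smul_mem_volMultiples (f : K.Fun) {w : K.Forms} (hw : w ∈ K.volMultiples) :
    f • w ∈ K.volMultiples := by
  rw [Algebra.smul_def, ← form_fn]
  exact K.form_mul_mem_volMultiples _ hw

theorem mem_volMultiples_of_smul {c : ℂ} (hc : c ≠ 0) {w : K.Forms}
    (hw : c • w ∈ K.volMultiples) : w ∈ K.volMultiples :=
  (Submodule.smul_mem_iff _ hc).mp hw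

theorem vol_mem_volMultiples : K.vol ∈ K.volMultiples := ⟨1, by simp⟩

/-- The product of the one-forms `dx^i`, for `i` in a list. -/
noncomputable def word (l : List (Fin 4)) : K.Forms := (l.map K.dx).prod

theorem word_cons (i : Fin 4) (l : List (Fin 4)) : K.word (i :: l) = K.dx i * K.word l := by
  simp [word]

theorem word_append (p q : List (Fin 4)) : K.word (p ++ q) = K.word p * K.word q := by
  simp [word]

theorem word_nil : K.word [] = 1 := rfl

theorem word_mul_dt_mul (p : List (Fin 4)) (w : K.Forms) :
    K.word p * (K.dt * w) = (-1 : ℂ) ^ p.length • (K.dt * (K.word p * w)) := by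
  induction p with
  | nil => simp [word_nil]
  | cons i p ih =>
    rw [word_cons, mul_assoc, ih, mul_smul_comm, dform_mul_dt_mul, smul_neg, List.length_cons,
      pow_succ, mul_neg_one, neg_smul, mul_assoc]

theorem dt_mul_word_mul (p : List (Fin 4)) (w : K.Forms) :
    K.dt * (K.word p * w) = (-1 : ℂ) ^ p.length • (K.word p * (K.dt * w)) := by
  rw [word_mul_dt_mul, smul_smul, ← mul_pow]
  simp

theorem dt_mul_dx_mul_X (i j : Fin 4) (w : K.Forms) : K.dt * (K.dx j * (K.X i * w)) =
    K.A j i • (K.dt * (K.X i * (K.dx j * w))) := by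
  rw [dt_mul_X_mul_dx, smul_smul, A_mul_A, one_smul]

/-- Behind dt a generator moves to the front at the cost of a coefficient that depends only on the
word passed. -/
theorem dt_mul_word_mul_X (p : List (Fin 4)) (i : Fin 4) : ∃ f : K.Fun, ∀ w : K.Forms,
    K.dt * (K.word p * (K.X i * w)) = f • (K.X i * (K.dt * (K.word p * w))) := by
  induction p with
  | nil => exact ⟨1, fun w => by simp [word_nil, form_mul_dt_mul]⟩
  | cons j p ih =>
    obtain ⟨f, hf⟩ := ih
    refine ⟨f * K.A j i, fun w => ?_⟩
    rw [word_cons, mul_assoc, ← neg_neg (K.dt * _), ← dform_mul_dt_mul, hf, mul_smul_comm,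
      form_mul_dt_mul, dform_mul_dt_mul, dt_mul_dx_mul_X, form_mul_dt_mul, smul_neg, neg_neg,
      smul_smul, mul_assoc]

/-- Behind dt the letters anticommute up to coefficients. The four words with distinct letters are
scalar multiples of the four products of ω with a generator. -/
theorem dt_mul_word_mem {l : List (Fin 4)} (hl : l.length = 3) :
    K.dt * K.word l ∈ K.volMultiples := by
  have hP : ∀ (p : List (Fin 4)) (i j : Fin 4) (q : List (Fin 4)),
      p.length + (q.length + 2) = 3 → K.dt * K.word (p ++ j :: i :: q) ∈ K.volMultiples →
        K.dt * K.word (p ++ i :: j :: q) ∈ K.volMultiples := by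
    intro p i j q _ h
    have h1 : K.dt * K.word (p ++ i :: j :: q) = -(K.A i j • (K.dt * K.word (p ++ j :: i :: q))) := by
      rw [word_append, word_append, word_cons, word_cons, word_cons, word_cons, dt_mul_word_mul,
        dt_mul_dx_mul_dx, mul_neg, smul_neg, mul_smul_comm, smul_comm, ← dt_mul_word_mul]
    rw [h1]
    exact neg_mem (K.smul_mem_volMultiples _ h)
  rcases exists_perm_of_length_three l hl with ⟨i, q, h⟩ | ⟨k, h⟩
  · refine of_perm_of_swap (P := fun l => K.dt * K.word l ∈ K.volMultiples) hP h hl ?_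
    rw [word_cons, word_cons, dx_mul_dx_self_mul, mul_zero]
    exact zero_mem _
  · refine of_perm_of_swap (P := fun l => K.dt * K.word l ∈ K.volMultiples) hP h hl ?_
    have h0 := K.form_mul_mem_volMultiples (K.x 0) K.vol_mem_volMultiples
    have h1 := K.form_mul_mem_volMultiples (K.x 1) K.vol_mem_volMultiples
    have h2 := K.form_mul_mem_volMultiples (K.x 2) K.vol_mem_volMultiples
    have h3 := K.form_mul_mem_volMultiples (K.x 3) K.vol_mem_volMultiples
    rw [form_mul_vol] at h2 h3
    replace h0 := Submodule.smul_mem _ (4 : ℂ) h0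
    replace h1 := Submodule.smul_mem _ (4 : ℂ) h1
    replace h2 := Submodule.smul_mem _ (4 : ℂ) h2
    replace h3 := Submodule.smul_mem _ (4 : ℂ) h3
    rw [X_zero_mul_vol] at h0
    rw [X_one_mul_vol, neg_mem_iff] at h1
    rw [vol_mul_X_two] at h2
    rw [vol_mul_X_three, neg_mem_iff] at h3
    replace h0 := K.mem_volMultiples_of_smul two_ne_zero h0
    replace h1 := K.mem_volMultiples_of_smul two_ne_zero h1
    replace h2 := K.mem_volMultiples_of_smul two_ne_zero h2
    replace h3 := K.mem_volMultiples_of_smul two_ne_zero h3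
    rw [area_two] at h0 h1
    rw [area_zero, mul_assoc] at h2 h3
    have hw : ∀ i j k, K.word [i, j, k] = K.dx i * (K.dx j * K.dx k) := by simp [word]
    -- The word that omits k comes from the product of ω with the adjoint of x^k, hence the crossed
    -- order of the four cases.
    fin_cases k
    · rwa [← hw] at h1
    · rwa [← hw] at h0
    · rwa [← hw] at h3
    · rwa [← hw] at h2

/-- Each swap leaves a remainder with one dt, three letters and a stray generator, which `hX`
absorbs. The sorted word is 4tω. -/
theorem word_mem {l : List (Fin 4)} (hl : l.length = 4) : K.word l ∈ K.volMultiples := by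
  have hX : ∀ (p : List (Fin 4)) (i : Fin 4) (q : List (Fin 4)), p.length + q.length = 3 →
      K.dt * (K.word p * (K.X i * K.word q)) ∈ K.volMultiples := by
    intro p i q h
    obtain ⟨f, hf⟩ := K.dt_mul_word_mul_X p i
    rw [hf, ← word_append]
    exact K.smul_mem_volMultiples _ (K.form_mul_mem_volMultiples _
      (K.dt_mul_word_mem (by rwa [List.length_append])))
  have hP : ∀ (p : List (Fin 4)) (i j : Fin 4) (q : List (Fin 4)),
      p.length + (q.length + 2) = 4 → K.word (p ++ j :: i :: q) ∈ K.volMultiples →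
        K.word (p ++ i :: j :: q) ∈ K.volMultiples := by
    intro p i j q hpq h
    have h1 : K.word (p ++ i :: j :: q) = -(K.A i j • K.word (p ++ j :: i :: q))
        + K.β i j • ((-1 : ℂ) ^ p.length • (K.dt * (K.word p * (K.X i * K.word (j :: q)))
          - K.dt * (K.word (p ++ [i]) * (K.X j * K.word q)))) := by
      rw [word_append, word_append, word_append, word_cons, word_cons, word_cons, word_cons,
        word_cons, word_nil, mul_one, ← mul_assoc (K.dx i), dx_mul_dx, smul_sub,
        mul_assoc (K.word p) (K.dx i), ← word_mul_dt_mul, ← word_mul_dt_mul]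
      simp only [add_mul, mul_add, neg_mul, mul_neg, smul_mul_assoc, mul_smul_comm, mul_assoc,
        sub_mul, mul_sub]
    rw [h1]
    refine add_mem (neg_mem (K.smul_mem_volMultiples _ h)) (K.smul_mem_volMultiples _
      (Submodule.smul_mem _ _ (sub_mem (hX _ _ _ ?_) (hX _ _ _ ?_))))
    · simp; omega
    · simp; omega
  rcases exists_perm_of_length_four l hl with ⟨i, q, h⟩ | h
  · refine of_perm_of_swap (P := fun l => K.word l ∈ K.volMultiples) hP h hl ?_
    rw [word_cons, word_cons, dx_mul_dx_self_mul]
    exact zero_mem _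
  · refine of_perm_of_swap (P := fun l => K.word l ∈ K.volMultiples) hP h hl ?_
    have h0 := Submodule.smul_mem _ (4 : ℂ)
      (K.smul_mem_volMultiples K.t K.vol_mem_volMultiples)
    rw [t_smul_vol, area_zero, area_two, mul_assoc] at h0
    simpa [word] using h0

/-- The span of the forms `y dx^{i_1} ⋯ dx^{i_n}` and `y dt dx^{i_2} ⋯ dx^{i_n}`. -/
noncomputable def words (n : ℕ) : Submodule ℂ K.Forms :=
  Submodule.span ℂ ({w | ∃ y l, l.length = n ∧ w = K.form y * K.word l} ∪
    {w | ∃ y l, l.length + 1 = n ∧ w = K.form y * (K.dt * K.word l)})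

theorem words_le {n : ℕ} {p : Submodule ℂ K.Forms}
    (h1 : ∀ y l, l.length = n → K.form y * K.word l ∈ p)
    (h2 : ∀ y l, l.length + 1 = n → K.form y * (K.dt * K.word l) ∈ p) : K.words n ≤ p := by
  refine Submodule.span_le.mpr ?_
  rintro w (⟨y, l, hl, rfl⟩ | ⟨y, l, hl, rfl⟩)
  exacts [h1 y l hl, h2 y l hl]

theorem form_mul_word_mem {n : ℕ} (y : K.Sphere) {l : List (Fin 4)} (hl : l.length = n) :
    K.form y * K.word l ∈ K.words n :=
  Submodule.subset_span (Or.inl ⟨y, l, hl, rfl⟩)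

theorem form_mul_dt_mul_word_mem {n : ℕ} (y : K.Sphere) {l : List (Fin 4)}
    (hl : l.length + 1 = n) : K.form y * (K.dt * K.word l) ∈ K.words n :=
  Submodule.subset_span (Or.inr ⟨y, l, hl, rfl⟩)

theorem form_mul_mem_words {n : ℕ} (z : K.Sphere) {w : K.Forms} (hw : w ∈ K.words n) :
    K.form z * w ∈ K.words n := by
  refine (K.words_le (p := (K.words n).comap (LinearMap.mulLeft ℂ (K.form z)))
    (fun y l hl => ?_) fun y l hl => ?_) hw
  · rw [Submodule.mem_comap, LinearMap.mulLeft_apply, ← mul_assoc, ← form_mul]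
    exact K.form_mul_word_mem _ hl
  · rw [Submodule.mem_comap, LinearMap.mulLeft_apply, ← mul_assoc, ← form_mul]
    exact K.form_mul_dt_mul_word_mem _ hl

theorem dt_mul_mem_words {n : ℕ} {w : K.Forms} (hw : w ∈ K.words n) :
    K.dt * w ∈ K.words (n + 1) := by
  refine (K.words_le (p := (K.words (n + 1)).comap (LinearMap.mulLeft ℂ K.dt))
    (fun y l hl => ?_) fun y l hl => ?_) hw
  · rw [Submodule.mem_comap, LinearMap.mulLeft_apply, ← form_mul_dt_mul]
    exact K.form_mul_dt_mul_word_mem _ (by rw [hl])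
  · rw [Submodule.mem_comap, LinearMap.mulLeft_apply, ← form_mul_dt_mul, dt_mul_dt_mul, mul_zero]
    exact zero_mem _

/-- Moving dx^i past a function costs at most a dt term. Together with dt² = 0 this explains why the
two families in `words` suffice. -/
theorem dx_mul_form (i : Fin 4) (y : K.Sphere) : ∃ y' y'' : K.Sphere,
    K.dx i * K.form y = K.form y' * K.dx i + K.form y'' * K.dt := by
  induction y using K.sphere_induction with
  | hfn f => exact ⟨K.fn f, 0, by rw [fn_mul_dx, form_zero, zero_mul, add_zero]⟩
  | hx j =>
    refine ⟨K.A i j • K.x j, -((K.A i j * K.β j i) • (K.x j * K.x i)), ?_⟩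
    rw [form_neg, form_smul, form_smul, smul_mul_assoc,
      K.X_mul_dx j i, smul_add, smul_smul, A_mul_A, one_smul, smul_smul, neg_mul, smul_mul_assoc,
      form_mul_dt, form_mul, add_neg_cancel_right]
  | hadd y z hy hz =>
    obtain ⟨y1, y2, hy⟩ := hy
    obtain ⟨z1, z2, hz⟩ := hz
    refine ⟨y1 + z1, y2 + z2, ?_⟩
    rw [form_add, form_add, form_add, mul_add, hy, hz, add_mul, add_mul]
    abel
  | hmul y z hy hz =>
    obtain ⟨y1, y2, hy⟩ := hy
    obtain ⟨z1, z2, hz⟩ := hz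
    refine ⟨y1 * z1, y1 * z2 + y2 * z, ?_⟩
    rw [form_mul, form_mul, form_add, form_mul, form_mul, ← mul_assoc, hy, add_mul, add_mul,
      mul_assoc, hz, mul_add, mul_assoc (K.form y2), ← form_mul_dt]
    simp only [mul_assoc, add_assoc]

theorem dx_mul_mem_words {n : ℕ} (i : Fin 4) {w : K.Forms} (hw : w ∈ K.words n) :
    K.dx i * w ∈ K.words (n + 1) := by
  refine (K.words_le (p := (K.words (n + 1)).comap (LinearMap.mulLeft ℂ (K.dx i)))
    (fun y l hl => ?_) fun y l hl => ?_) hw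
  · rw [Submodule.mem_comap, LinearMap.mulLeft_apply]
    obtain ⟨y1, y2, hy⟩ := K.dx_mul_form i y
    rw [← mul_assoc, hy, add_mul, mul_assoc, mul_assoc, ← word_cons]
    exact add_mem (K.form_mul_word_mem _ (by simp [hl]))
      (K.form_mul_dt_mul_word_mem _ (by rw [hl]))
  · rw [Submodule.mem_comap, LinearMap.mulLeft_apply]
    obtain ⟨y1, y2, hy⟩ := K.dx_mul_form i y
    rw [← mul_assoc, hy, add_mul, mul_assoc, mul_assoc, dt_mul_dt_mul, mul_zero, add_zero,
      dform_mul_dt_mul, mul_neg, ← word_cons]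
    exact neg_mem (K.form_mul_dt_mul_word_mem _ (by simp [hl]))

theorem dform_mul_mem_words {n : ℕ} (z : K.Sphere) {w : K.Forms} (hw : w ∈ K.words n) :
    K.dform z * w ∈ K.words (n + 1) := by
  induction z using K.sphere_induction generalizing w with
  | hfn f =>
    rw [dform_fn, mul_assoc]
    exact K.form_mul_mem_words _ (K.dt_mul_mem_words hw)
  | hx i => exact K.dx_mul_mem_words i hw
  | hadd y z hy hz =>
    rw [dform_add, add_mul]
    exact add_mem (hy hw) (hz hw)
  | hmul y z hy hz =>
    rw [dform_mul, add_mul, mul_assoc, mul_assoc]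
    exact add_mem (hy (K.form_mul_mem_words z hw)) (K.form_mul_mem_words y (hz hw))

theorem prod_dform_mem_words {n : ℕ} (y : Fin n → K.Sphere) :
    (List.ofFn fun i => K.dform (y i)).prod ∈ K.words n := by
  induction n with
  | zero =>
    have h := K.form_mul_word_mem 1 (l := []) rfl
    rwa [form_one, one_mul] at h
  | succ n ih =>
    rw [List.ofFn_succ, List.prod_cons]
    exact K.dform_mul_mem_words _ (ih fun i => y i.succ)

theorem formsOfDegree_le_words (n : ℕ) : K.formsOfDegree n ≤ K.words n := by
  refine Submodule.span_le.mpr ?_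
  rintro w ⟨y₀, y, rfl⟩
  exact K.form_mul_mem_words _ (K.prod_dform_mem_words y)

theorem formsOfDegree_four_le : K.formsOfDegree 4 ≤ K.volMultiples :=
  (K.formsOfDegree_le_words 4).trans (K.words_le
    (fun y _ hl => K.form_mul_mem_volMultiples y (K.word_mem hl))
    fun y _ hl => K.form_mul_mem_volMultiples y (K.dt_mul_word_mem (Nat.succ_injective hl)))

theorem form_mul_mem_formsOfDegree {n : ℕ} (z : K.Sphere) {w : K.Forms}
    (hw : w ∈ K.formsOfDegree n) : K.form z * w ∈ K.formsOfDegree n := by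
  refine (Submodule.span_le (p := (K.formsOfDegree n).comap (LinearMap.mulLeft ℂ (K.form z)))).mpr
    ?_ hw
  rintro w ⟨y₀, y, rfl⟩
  exact Submodule.subset_span ⟨z * y₀, y, by
    rw [LinearMap.mulLeft_apply, form_mul, mul_assoc]⟩

theorem prod_dform_mem (y : Fin 4 → K.Sphere) :
    K.dform (y 0) * (K.dform (y 1) * (K.dform (y 2) * K.dform (y 3))) ∈ K.formsOfDegree 4 :=
  Submodule.subset_span ⟨1, y, by simp [form_one, List.ofFn_succ]⟩

theorem vol_mem : K.vol ∈ K.formsOfDegree 4 := by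
  have h1 := K.form_mul_mem_formsOfDegree (K.fn K.t) (K.prod_dform_mem ![K.x 0, K.x 1, K.x 2, K.x 3])
  have h2 := K.form_mul_mem_formsOfDegree (K.x 0)
    (K.prod_dform_mem ![K.fn K.t, K.x 1, K.x 2, K.x 3])
  have h3 := K.form_mul_mem_formsOfDegree (K.x 3)
    (K.prod_dform_mem ![K.fn K.t, K.x 0, K.x 1, K.x 2])
  -- The last summand of ω ends in b*, which must be brought to the left end to match the shape of
  -- the spanning forms.
  have hX : K.X 3 * K.dx 2 = K.dx 2 * K.X 3 := K.X_conj_mul_dx 2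
  have h : K.X 3 * (K.dt * (K.area 0 * K.dx 2)) = K.dt * (K.area 0 * (K.dx 2 * K.X 3)) := by
    rw [form_mul_dt_mul, dt_mul_X_mul_area, hX]
  refine (Submodule.smul_mem_iff _ (by norm_num : (4 : ℂ) ≠ 0)).mp ?_
  rw [four_smul_vol, ← h, ← form_mul_dt_mul, area_zero, area_two, Algebra.smul_def K.t, ← form_fn,
    mul_assoc, mul_assoc]
  exact add_mem (sub_mem h1 (Submodule.smul_mem _ _ h2)) (Submodule.smul_mem _ _ h3)

end Coeff

end DynSphere

namespace DynSphere

namespace Coeff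

variable {φ : ℝ → ℝ} {hφ : ContDiffOn ℝ ∞ φ (Set.Icc (-1) 1)} (K : Coeff φ hφ)

/-! ### Representations of the differential algebra -/

/-- Operators `X y`, for `y` in the sphere algebra, one-forms `θ i` and `τ` that commute with the
generators up to the factors `A`, and weight operators `ν i`. -/
structure Frame (R : Type*) [Ring R] [Algebra K.Fun R] where
  X : K.Sphere →ₐ[K.Fun] R
  θ : Fin 4 → R
  τ : R
  ν : Fin 4 → R
  X_θ (i j : Fin 4) : X (K.x i) * θ j = K.A i j • (θ j * X (K.x i))
  X_τ (y : K.Sphere) : X y * τ = τ * X y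
  θ_θ (i j : Fin 4) : θ i * θ j = -(K.A i j • (θ j * θ i))
  θ_τ (i : Fin 4) : θ i * τ = -(τ * θ i)
  τ_τ : τ * τ = 0
  ν_X (j i : Fin 4) : ν j * X (K.x i) = X (K.x i) * ν j + K.β j i • X (K.x i)
  ν_θ (j i : Fin 4) : ν j * θ i = θ i * ν j + K.β j i • θ i
  ν_τ (j : Fin 4) : ν j * τ = τ * ν j
  ν_conj (j : Fin 4) : ν (conj j) = -ν j

/-- The coefficient `1 / 2`. -/
noncomputable def half : K.Fun := algebraMap ℂ K.Fun (1 / 2)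

theorem half_add_half : K.half + K.half = 1 := by
  rw [half, ← map_add]
  norm_num

theorem half_smul_two {R : Type*} [AddCommGroup R] [Module K.Fun R] (r : R) :
    K.half • (r + r) = r := by
  rw [smul_add, ← add_smul, half_add_half, one_smul]

theorem eq_zero_of_eq_neg {R : Type*} [AddCommGroup R] [Module K.Fun R] {r : R} (h : r = -r) :
    r = 0 := by
  rw [← K.half_smul_two r]
  nth_rw 1 [h]
  rw [neg_add_cancel, smul_zero]

namespace Frame

variable {K} {R : Type*} [Ring R] [Algebra K.Fun R] (F : K.Frame R)

/-- The generators. -/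
noncomputable abbrev x (i : Fin 4) : R := F.X (K.x i)

theorem x_x (i j : Fin 4) : F.x i * F.x j = K.A i j • (F.x j * F.x i) := by
  rw [x, x, ← map_mul, x_mul_x, map_smul, map_mul]

/-- The invariant one-form `x^j θ^{j*}`. -/
noncomputable def inv (j : Fin 4) : R := F.x j * F.θ (conj j)

/-- The factors of x^j and θ^{j*} cancel, so their product commutes like τ; likewise its total
weight is zero in `ν_inv`. -/
theorem x_inv (i j : Fin 4) : F.x i * F.inv j = F.inv j * F.x i := by
  rw [inv, ← mul_assoc, x_x, smul_mul_assoc, mul_assoc, X_θ, mul_smul_comm, smul_smul,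
    A_conj_right, A_mul_A, one_smul, mul_assoc]

theorem θ_inv (i j : Fin 4) : F.θ i * F.inv j = -(F.inv j * F.θ i) := by
  have h : F.θ i * F.x j = K.A i j • (F.x j * F.θ i) := by
    rw [X_θ, smul_smul, A_mul_A, one_smul]
  rw [inv, ← mul_assoc, h, smul_mul_assoc, mul_assoc, θ_θ, mul_neg, smul_neg, mul_smul_comm,
    smul_smul, A_conj_right, A_mul_A, one_smul, mul_assoc]

theorem τ_inv (j : Fin 4) : F.τ * F.inv j = -(F.inv j * F.τ) := by
  rw [inv, ← mul_assoc, ← X_τ, mul_assoc, mul_assoc, θ_τ, mul_neg, neg_neg]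

theorem ν_inv (i j : Fin 4) : F.ν i * F.inv j = F.inv j * F.ν i := by
  rw [inv, ← mul_assoc, ν_X, add_mul, mul_assoc, ν_θ, mul_add, β_conj_right, smul_mul_assoc,
    mul_smul_comm, neg_smul, neg_add_cancel_right, mul_assoc]

/-- Half the differential of the square of the radius. -/
noncomputable def radial : R := K.half • ∑ j, F.inv j + K.t • F.τ

theorem X_radial (y : K.Sphere) : F.X y * F.radial = F.radial * F.X y := by
  induction y using K.sphere_induction with
  | hfn f =>
    rw [fn, AlgHom.commutes]
    exact Algebra.commutes f _
  | hx i =>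
    simp only [radial, mul_add, add_mul, mul_smul_comm, smul_mul_assoc, Finset.mul_sum,
      Finset.sum_mul, F.X_τ, F.x_inv i]
  | hadd y z hy hz => rw [map_add, add_mul, mul_add, hy, hz]
  | hmul y z hy hz => rw [map_mul, mul_assoc, hz, ← mul_assoc, hy, mul_assoc]

theorem θ_radial (i : Fin 4) : F.θ i * F.radial = -(F.radial * F.θ i) := by
  simp only [radial, mul_add, add_mul, mul_smul_comm, smul_mul_assoc, Finset.mul_sum,
    Finset.sum_mul, F.θ_τ, F.θ_inv i, Finset.sum_neg_distrib, smul_neg, neg_add]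

theorem τ_radial : F.τ * F.radial = -(F.radial * F.τ) := by
  simp only [radial, mul_add, add_mul, mul_smul_comm, smul_mul_assoc, Finset.mul_sum,
    Finset.sum_mul, F.τ_τ, F.τ_inv, Finset.sum_neg_distrib, smul_neg, neg_add, smul_zero, neg_zero]

theorem ν_radial (i : Fin 4) : F.ν i * F.radial = F.radial * F.ν i := by
  simp only [radial, mul_add, add_mul, mul_smul_comm, smul_mul_assoc, Finset.mul_sum,
    Finset.sum_mul, F.ν_τ, F.ν_inv i]

/-- The radial form commutes with generators and anticommutes with one-forms, hence anticommutes
with itself; and 2 is invertible. -/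
theorem radial_radial : F.radial * F.radial = 0 := by
  have h : ∀ j, F.inv j * F.radial = -(F.radial * F.inv j) := fun j => by
    rw [inv, mul_assoc, θ_radial, mul_neg, ← mul_assoc, X_radial, mul_assoc]
  refine K.eq_zero_of_eq_neg ?_
  conv_lhs =>
    enter [1]
    rw [radial]
  rw [add_mul, smul_mul_assoc, smul_mul_assoc, τ_radial, Finset.sum_mul]
  conv_rhs =>
    enter [1, 2]
    rw [radial]
  rw [mul_add, mul_smul_comm, mul_smul_comm, Finset.mul_sum]
  simp only [h, Finset.sum_neg_distrib, smul_neg, neg_add]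

/-- The projection of the one-forms to the tangential directions. -/
noncomputable def tangent : K.Frame R where
  X := F.X
  θ i := F.θ i - F.x i * F.radial
  τ := F.τ - K.t • F.radial
  ν := F.ν
  X_θ i j := by
    rw [mul_sub, sub_mul, smul_sub, X_θ, ← mul_assoc, x_x, smul_mul_assoc, mul_assoc, mul_assoc,
      X_radial]
  X_τ y := by
    rw [mul_sub, sub_mul, X_τ, mul_smul_comm, smul_mul_assoc, X_radial]
  -- The subtracted x^i ρ obeys the same exchange rules as θ^i, and products of two such terms
  -- vanish because ρ² = 0.
  θ_θ i j := by
    have hz : ∀ i j, F.x i * F.radial * (F.x j * F.radial) = 0 := fun i j => by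
      rw [mul_assoc, ← mul_assoc F.radial, ← X_radial, mul_assoc, radial_radial, mul_zero, mul_zero]
    have h1 : ∀ i j, F.θ i * (F.x j * F.radial) =
        K.A i j • (F.x j * (F.θ i * F.radial)) := fun i j => by
      rw [← mul_assoc (F.x j), X_θ, smul_mul_assoc, smul_smul, A_mul_A, one_smul, mul_assoc]
    have h2 : ∀ i j, F.x i * F.radial * F.θ j = -(F.x i * (F.θ j * F.radial)) := fun i j => by
      rw [θ_radial, mul_neg, neg_neg, mul_assoc]
    have h3 : K.A i j • K.A j i • (F.x i * (F.θ j * F.radial)) =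
        F.x i * (F.θ j * F.radial) := by
      rw [smul_smul, A_mul_A, one_smul]
    rw [mul_sub, sub_mul, sub_mul, mul_sub, sub_mul, sub_mul, hz, hz, h1, h1, h2, h2, F.θ_θ i j]
    simp only [smul_sub, smul_neg, smul_zero, h3]
    abel
  θ_τ i := by
    have h : F.τ * (F.x i * F.radial) = -(F.x i * (F.radial * F.τ)) := by
      rw [← mul_assoc, ← X_τ, mul_assoc, τ_radial, mul_neg]
    simp only [mul_sub, sub_mul, mul_smul_comm, smul_mul_assoc, θ_τ, θ_radial, mul_assoc,
      radial_radial, h, ← F.X_radial, ← mul_assoc F.radial]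
    simp only [mul_zero, smul_zero]
    module
  τ_τ := by
    simp only [mul_sub, sub_mul, mul_smul_comm, smul_mul_assoc, τ_τ, radial_radial, τ_radial]
    simp
  ν_X := F.ν_X
  ν_θ j i := by
    rw [mul_sub, ν_θ, ← mul_assoc, ν_X, add_mul, mul_assoc, ν_radial, smul_mul_assoc, sub_mul,
      smul_sub, mul_assoc]
    abel
  ν_τ j := by
    rw [mul_sub, sub_mul, ν_τ, mul_smul_comm, ν_radial, smul_mul_assoc]
  ν_conj := F.ν_conj

/-- The new radial form is ρ − (aa* + bb* + t²)ρ. -/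
theorem tangent_radial : F.tangent.radial = 0 := by
  have h : ∀ j, F.tangent.inv j = F.inv j - F.x j * F.x (conj j) * F.radial := fun j => by
    change F.x j * (F.θ _ - F.x _ * F.radial) = _
    rw [mul_sub, inv, mul_assoc]
  have h2 : F.x 0 * F.x 1 + F.x 2 * F.x 3 + K.t ^ 2 • (1 : R) = 1 := by
    have h3 := congrArg F.X K.sphere_eq
    rwa [map_add, map_add, map_mul, map_mul, map_one, fn, AlgHom.commutes,
      Algebra.algebraMap_eq_smul_one] at h3
  have h4 : ∑ j, F.x j * F.x (conj j) =
      (F.x 0 * F.x 1 + F.x 2 * F.x 3) + (F.x 0 * F.x 1 + F.x 2 * F.x 3) := by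
    have h5 : F.x 1 * F.x 0 = F.x 0 * F.x 1 := by
      rw [x_x]
      simp [A]
    have h6 : F.x 3 * F.x 2 = F.x 2 * F.x 3 := by
      rw [x_x]
      simp [A]
    rw [Fin.sum_univ_four]
    change F.x 0 * F.x 1 + F.x 1 * F.x 0 + F.x 2 * F.x 3 + F.x 3 * F.x 2 = _
    rw [h5, h6]
    abel
  rw [radial]
  simp only [h, Finset.sum_sub_distrib, ← Finset.sum_mul]
  rw [h4, smul_sub, ← smul_mul_assoc, half_smul_two]
  change K.half • ∑ j, F.inv j - _ + K.t • (F.τ - K.t • F.radial) = 0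
  have h7 : (F.x 0 * F.x 1 + F.x 2 * F.x 3) * F.radial + K.t • (K.t • F.radial) = F.radial := by
    have h8 := congrArg (· * F.radial) h2
    simpa only [add_mul, smul_mul_assoc, one_mul, smul_smul, sq] using h8
  rw [smul_sub, sub_add_sub_comm, h7]
  exact sub_self _

/-- The one-form that represents `dx^i`. -/
noncomputable def dx (i : Fin 4) : R := F.θ i + F.τ * (F.x i * F.ν i)

theorem τ_mul_τ_mul (r : R) : F.τ * (F.τ * r) = 0 := by
  rw [← mul_assoc, τ_τ, zero_mul]

theorem dx_τ (i : Fin 4) : F.dx i * F.τ = -(F.τ * F.dx i) := by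
  rw [dx, add_mul, mul_add, θ_τ, τ_mul_τ_mul, mul_assoc, mul_assoc, ν_τ, ← mul_assoc (F.x i),
    X_τ, mul_assoc, τ_mul_τ_mul, add_zero, add_zero]

theorem τ_x_mul (i : Fin 4) (r : R) : F.x i * (F.τ * r) = F.τ * (F.x i * r) := by
  rw [← mul_assoc, X_τ, mul_assoc]

/-- The correction τ x^j ν_j is designed for this: moving ν_j past x^i contributes β_ji = −β_ij,
which is the required ½B term. -/
theorem x_dx (i j : Fin 4) : F.x i * F.dx j =
    K.A i j • (F.dx j * F.x i) + K.β i j • (F.τ * (F.x i * F.x j)) := by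
  rw [dx, mul_add, X_θ, τ_x_mul, add_mul, mul_assoc, mul_assoc, ν_X, mul_add, mul_smul_comm,
    mul_add, smul_add, smul_add, ← mul_assoc (F.x j), ← mul_assoc (F.x i), F.x_x i j,
    smul_mul_assoc, mul_smul_comm, mul_smul_comm, mul_smul_comm, add_assoc, β_swap]
  simp only [smul_neg, neg_smul]
  rw [smul_comm (K.β i j), mul_assoc]
  abel

theorem τ_x_dx (i j : Fin 4) : F.τ * (F.x i * F.dx j) = F.τ * (F.x i * F.θ j) := by
  rw [dx, mul_add, τ_x_mul, mul_add, τ_mul_τ_mul, add_zero]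

theorem τ_dx_x (i j : Fin 4) : F.τ * (F.dx i * F.x j) = F.τ * (F.θ i * F.x j) := by
  rw [dx, add_mul, mul_add, mul_assoc F.τ, τ_mul_τ_mul, add_zero]

theorem dx_dx_eq (i j : Fin 4) : F.dx i * F.dx j = F.θ i * F.θ j
    + F.τ * (F.x i * (F.θ j * F.ν i) + K.β i j • (F.x i * F.θ j) - F.θ i * (F.x j * F.ν j)) := by
  have h1 : F.θ i * (F.τ * (F.x j * F.ν j)) = -(F.τ * (F.θ i * (F.x j * F.ν j))) := by
    rw [← mul_assoc, θ_τ, neg_mul, mul_assoc]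
  have h2 : F.τ * (F.x i * F.ν i) * (F.τ * (F.x j * F.ν j)) = 0 := by
    rw [mul_assoc, mul_assoc, ← mul_assoc (F.ν i), ν_τ, mul_assoc F.τ (F.ν i), τ_x_mul,
      τ_mul_τ_mul]
  rw [dx, dx, add_mul, mul_add, mul_add, h1, h2, mul_assoc, mul_assoc, ν_θ, mul_sub, mul_add,
    mul_add, mul_add, mul_smul_comm]
  abel

theorem dx_dx (i j : Fin 4) : F.dx i * F.dx j = -(K.A i j • (F.dx j * F.dx i))
    + K.β i j • (F.τ * (F.x i * F.dx j - F.dx i * F.x j)) := by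
  have h1 : K.A i j • (F.x j * (F.θ i * F.ν j)) = F.θ i * (F.x j * F.ν j) := by
    rw [← mul_assoc, X_θ, smul_mul_assoc, smul_smul, A_mul_A, one_smul, mul_assoc]
  have h2 : K.A i j • (F.θ j * (F.x i * F.ν i)) = F.x i * (F.θ j * F.ν i) := by
    rw [← mul_assoc, ← smul_mul_assoc, ← X_θ, mul_assoc]
  have h3 : K.A i j • (F.x j * F.θ i) = F.θ i * F.x j := by
    rw [X_θ, smul_smul, A_mul_A, one_smul]
  rw [mul_sub, τ_x_dx, τ_dx_x, dx_dx_eq, dx_dx_eq, F.θ_θ i j, smul_add, ← mul_smul_comm _ F.τ, smul_sub,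
    smul_add, h1, h2, smul_comm (K.A i j), h3, K.β_swap i j]
  simp only [mul_sub, mul_add, smul_sub, mul_smul_comm, neg_smul, mul_neg]
  abel

/-- Adjoint generators have opposite weight operators, so the corrections cancel and the sphere
relation only involves the radial form. -/
theorem conj_relation (j : Fin 4) : F.x j * F.dx (conj j) + F.x (conj j) * F.dx j =
    F.inv j + F.inv (conj j) := by
  have h : F.x (conj j) * F.x j = F.x j * F.x (conj j) := by
    rw [x_x, A_conj_left, A_self, one_smul]
  rw [dx, dx, mul_add, mul_add, τ_x_mul, τ_x_mul, ← mul_assoc (F.x j), ← mul_assoc (F.x _), h,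
    ν_conj, mul_neg, mul_neg, inv, inv, conj_conj]
  abel

end Frame

end Coeff

end DynSphere

namespace DynSphere

namespace Coeff

variable {φ : ℝ → ℝ} {hφ : ContDiffOn ℝ ∞ φ (Set.Icc (-1) 1)} {K : Coeff φ hφ}

namespace Frame

variable {R : Type*} [Ring R] [Algebra K.Fun R] (F : K.Frame R)

/-! ### Jets and the derivation of a frame with vanishing radial form -/

theorem sphere_relation (h : F.radial = 0) : F.x 0 * F.dx 1 + F.x 1 * F.dx 0 + F.x 2 * F.dx 3
    + F.x 3 * F.dx 2 + (K.t + K.t) • F.τ = 0 := by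
  have h1 := F.conj_relation 0
  have h2 := F.conj_relation 2
  change F.x 0 * F.dx 1 + F.x 1 * F.dx 0 = F.inv 0 + F.inv 1 at h1
  change F.x 2 * F.dx 3 + F.x 3 * F.dx 2 = F.inv 2 + F.inv 3 at h2
  have h3 : (∑ j, F.inv j) + (K.t + K.t) • F.τ = F.radial + F.radial := by
    conv_lhs => rw [← K.half_smul_two (∑ j, F.inv j)]
    rw [radial]
    module
  rw [h, add_zero, Fin.sum_univ_four] at h3
  rw [← h3, h1, add_assoc (F.inv 0 + F.inv 1), h2]
  abel

/-- The map `f ↦ f + ε df` on the coefficients. -/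
noncomputable def coeffJet : K.Fun →+* DualNumber R where
  toFun f := TrivSqZeroExt.inl (algebraMap K.Fun R f) + TrivSqZeroExt.inr (K.deriv f • F.τ)
  map_one' := by
    ext <;> simp [deriv_one]
  map_mul' f g := by
    ext
    · simp
    · simp only [TrivSqZeroExt.snd_mul, TrivSqZeroExt.snd_add, TrivSqZeroExt.snd_inl,
        TrivSqZeroExt.snd_inr, TrivSqZeroExt.fst_add, TrivSqZeroExt.fst_inl, TrivSqZeroExt.fst_inr,
        zero_add, add_zero, smul_eq_mul, MulOpposite.smul_eq_mul_unop, MulOpposite.unop_op]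
      rw [deriv_mul, ← Algebra.commutes, ← Algebra.smul_def, ← Algebra.smul_def, smul_smul,
        smul_smul, add_smul]
  map_zero' := by
    ext <;> simp [deriv_zero]
  map_add' f g := by
    ext
    · simp
    · simp [deriv_add, add_smul]

theorem coeffJet_fst (f : K.Fun) : (F.coeffJet f).fst = algebraMap K.Fun R f := by
  simp [coeffJet]

theorem coeffJet_snd (f : K.Fun) : (F.coeffJet f).snd = K.deriv f • F.τ := by
  simp [coeffJet]

/-- The elements `r + ε s` that commute with all `f + ε df`. -/
def Jet : Subring (DualNumber R) := Subring.centralizer (Set.range F.coeffJet)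

/-- The jets f + ε df need not be central in the dual numbers over R. They do commute with r + εs
when r commutes with τ, and on their centralizer they define the algebra structure needed for the
universal property of the sphere. -/
theorem mem_jet {u : DualNumber R} (h : u.fst * F.τ = F.τ * u.fst) : u ∈ F.Jet := by
  rw [Jet, Subring.mem_centralizer_iff]
  rintro _ ⟨f, rfl⟩
  ext
  · simp [coeffJet_fst, Algebra.commutes]
  · simp [coeffJet_fst, coeffJet_snd, h, Algebra.commutes, add_comm]

/-- The map `f ↦ f + ε df`, with values in its centralizer. -/
noncomputable def coeffJetHom : K.Fun →+* F.Jet :=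
  F.coeffJet.codRestrict F.Jet fun f => F.mem_jet (by
    rw [coeffJet_fst, Algebra.commutes])

noncomputable instance : Algebra K.Fun F.Jet :=
  F.coeffJetHom.toAlgebra' fun f u => Subtype.ext (u.2 _ ⟨f, rfl⟩)

theorem jet_smul_fst (f : K.Fun) (u : F.Jet) : (f • u : F.Jet).1.fst = f • u.1.fst := by
  rw [Algebra.smul_def f u.1.fst, ← F.coeffJet_fst, Algebra.smul_def]
  rfl

theorem jet_smul_snd (f : K.Fun) (u : F.Jet) : (f • u : F.Jet).1.snd =
    f • u.1.snd + K.deriv f • (F.τ * u.1.fst) := by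
  have h : (f • u : F.Jet).1.snd = (F.coeffJet f * u.1).snd := by
    rw [Algebra.smul_def]
    rfl
  rw [h]
  simp [coeffJet_fst, coeffJet_snd, Algebra.smul_def, mul_assoc]

/-- The element `x^i + ε dx^i`. -/
noncomputable def xJet (i : Fin 4) : F.Jet :=
  ⟨TrivSqZeroExt.inl (F.x i) + TrivSqZeroExt.inr (F.dx i), F.mem_jet (by simp [F.X_τ])⟩

theorem xJet_fst (i : Fin 4) : (F.xJet i).1.fst = F.x i := by
  simp [xJet]

theorem xJet_snd (i : Fin 4) : (F.xJet i).1.snd = F.dx i := by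
  simp [xJet]

theorem jet_ext {u v : F.Jet} (h1 : u.1.fst = v.1.fst) (h2 : u.1.snd = v.1.snd) : u = v :=
  Subtype.ext (TrivSqZeroExt.ext h1 h2)

theorem jet_mul_fst (u v : F.Jet) : (u * v).1.fst = u.1.fst * v.1.fst :=
  TrivSqZeroExt.fst_mul u.1 v.1

theorem jet_mul_snd (u v : F.Jet) :
    (u * v).1.snd = u.1.fst * v.1.snd + u.1.snd * v.1.fst :=
  TrivSqZeroExt.snd_mul u.1 v.1

/-- The ε-part is the derivative of x^i x^j = A_ij x^j x^i. It requires A' = 2βA, one β for each of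
the two exchange rules; this accounts for the factor ½ in the relations. -/
theorem xJet_mul_xJet (i j : Fin 4) :
    F.xJet i * F.xJet j = K.A i j • (F.xJet j * F.xJet i) := by
  refine F.jet_ext ?_ ?_
  · rw [jet_smul_fst, jet_mul_fst, jet_mul_fst, xJet_fst, xJet_fst, x_x]
  · have h : K.A i j • (F.τ * (F.x j * F.x i)) = F.τ * (F.x i * F.x j) := by
      rw [F.x_x i j, mul_smul_comm]
    rw [jet_smul_snd, jet_mul_fst, jet_mul_snd, jet_mul_snd, xJet_fst, xJet_fst, xJet_snd,
      xJet_snd, x_dx, F.x_dx j i, K.β_swap i j, deriv_A, mul_smul, h, ← K.β_add_β, ← h]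
    simp only [smul_add, smul_smul, A_mul_A, one_smul]
    module

theorem algebraMap_jet_fst (f : K.Fun) :
    (algebraMap K.Fun F.Jet f).1.fst = algebraMap K.Fun R f := F.coeffJet_fst f

theorem algebraMap_jet_snd (f : K.Fun) :
    (algebraMap K.Fun F.Jet f).1.snd = K.deriv f • F.τ := F.coeffJet_snd f

/-- The map `y ↦ y + ε dy` on the sphere algebra. -/
noncomputable def jet (h : F.radial = 0) : K.Sphere →ₐ[K.Fun] F.Jet :=
  K.sphereLift F.xJet F.xJet_mul_xJet (by
    refine F.jet_ext ?_ ?_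
    · have h1 := congrArg F.X K.sphere_eq
      rw [map_add, map_add, map_mul, map_mul, map_one, fn, AlgHom.commutes] at h1
      change (F.xJet 0 * F.xJet 1).1.fst + (F.xJet 2 * F.xJet 3).1.fst
        + (algebraMap K.Fun F.Jet (K.t ^ 2)).1.fst = 1
      rw [algebraMap_jet_fst, jet_mul_fst, jet_mul_fst]
      simpa only [xJet_fst] using h1
    · have h1 : F.dx 0 * F.x 1 = F.x 1 * F.dx 0 := by
        rw [x_dx]
        simp [A, β, B, deriv_one]
      have h2 : F.dx 2 * F.x 3 = F.x 3 * F.dx 2 := by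
        rw [x_dx]
        simp [A, β, B, deriv_one]
      change (F.xJet 0 * F.xJet 1).1.snd + (F.xJet 2 * F.xJet 3).1.snd
        + (algebraMap K.Fun F.Jet (K.t ^ 2)).1.snd = 0
      rw [algebraMap_jet_snd, jet_mul_snd, jet_mul_snd]
      simp only [xJet_fst, xJet_snd]
      rw [h1, h2, ← F.sphere_relation h, sq, deriv_mul, deriv_t, mul_one]
      abel)

theorem jet_fst (h : F.radial = 0) (y : K.Sphere) : (F.jet h y).1.fst = F.X y := by
  induction y using K.sphere_induction with
  | hfn f => rw [fn, AlgHom.commutes, AlgHom.commutes, algebraMap_jet_fst]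
  | hx i => rw [jet, sphereLift_x, xJet_fst]
  | hadd y z hy hz =>
    rw [map_add, map_add, ← hy, ← hz]
    rfl
  | hmul y z hy hz => rw [map_mul, map_mul, jet_mul_fst, hy, hz]

/-- The derivation that represents `d`. -/
noncomputable def der (h : F.radial = 0) (y : K.Sphere) : R := (F.jet h y).1.snd

theorem der_add (h : F.radial = 0) (y z : K.Sphere) :
    F.der h (y + z) = F.der h y + F.der h z := by
  rw [der, map_add]
  rfl

theorem der_mul (h : F.radial = 0) (y z : K.Sphere) :
    F.der h (y * z) = F.der h y * F.X z + F.X y * F.der h z := by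
  rw [der, map_mul, jet_mul_snd, jet_fst, jet_fst, add_comm]
  rfl

theorem der_fn (h : F.radial = 0) (f : K.Fun) : F.der h (K.fn f) = K.deriv f • F.τ := by
  rw [der, fn, AlgHom.commutes, algebraMap_jet_snd]

theorem der_t (h : F.radial = 0) : F.der h (K.fn K.t) = F.τ := by
  rw [der_fn, deriv_t, one_smul]

theorem der_x (h : F.radial = 0) (i : Fin 4) : F.der h (K.x i) = F.dx i := by
  rw [der, jet, sphereLift_x, xJet_snd]

theorem X_fn (f : K.Fun) : F.X (K.fn f) = algebraMap K.Fun R f := by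
  rw [fn, AlgHom.commutes]

/-- This is the differential of the relation y dt = dt y. -/
theorem der_τ (h : F.radial = 0) (y : K.Sphere) : F.der h y * F.τ = -(F.τ * F.der h y) := by
  induction y using K.sphere_induction with
  | hfn f => rw [der_fn, smul_mul_assoc, mul_smul_comm, τ_τ, smul_zero, neg_zero]
  | hx i => rw [der_x, dx_τ]
  | hadd y z hy hz => rw [der_add, add_mul, mul_add, hy, hz, neg_add]
  | hmul y z hy hz =>
    rw [der_mul, add_mul, mul_add, mul_assoc, X_τ, ← mul_assoc, hy, mul_assoc (F.X y), hz, mul_neg,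
      ← mul_assoc (F.X y), X_τ, neg_mul, mul_assoc, mul_assoc, neg_add]

theorem τ_der (h : F.radial = 0) (y : K.Sphere) : F.τ * F.der h y = -(F.der h y * F.τ) := by
  rw [der_τ, neg_neg]

/-! ### Representing the universal algebra and its quotient Ω -/

variable [Algebra ℂ R] [IsScalarTower ℂ K.Fun R]

/-- The representation of the universal differential algebra. -/
noncomputable def univRep (h : F.radial = 0) : Univ K.Sphere →ₐ[ℂ] R :=
  Univ.lift (fun s => Sum.rec F.X (F.der h) s) (by
    have hc : ∀ c, F.der h (algebraMap ℂ K.Sphere c) = 0 := fun c => by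
      rw [← fn_algebraMap, der_fn, deriv_algebraMap, zero_smul]
    intro p q hpq
    cases hpq with
    | of_add x y => simp
    | of_mul x y => simp
    | of_scalar c =>
      rw [FreeAlgebra.lift_ι_apply, AlgHom.commutes]
      change F.X (algebraMap ℂ K.Sphere c) = _
      rw [← fn_algebraMap, X_fn, ← IsScalarTower.algebraMap_apply]
    | d_add x y => simpa using F.der_add h x y
    | d_smul c x =>
      have h1 : F.X (algebraMap ℂ K.Sphere c) = algebraMap ℂ R c := by
        rw [← fn_algebraMap, X_fn, ← IsScalarTower.algebraMap_apply]
      have h2 : F.der h (c • x) = c • F.der h x := by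
        rw [Algebra.smul_def, der_mul, hc, zero_mul, zero_add, h1, ← Algebra.smul_def]
      simpa using h2
    | d_mul x y => simpa using F.der_mul h x y)

theorem univRep_of (h : F.radial = 0) (y : K.Sphere) : F.univRep h (Univ.of y) = F.X y :=
  (Univ.lift_mk _ _ _).trans (FreeAlgebra.lift_ι_apply _ _)

theorem univRep_δ (h : F.radial = 0) (y : K.Sphere) : F.univRep h (Univ.δ y) = F.der h y :=
  (Univ.lift_mk _ _ _).trans (FreeAlgebra.lift_ι_apply _ _)

theorem univRep_oneFormRel (h : F.radial = 0) {r : Univ K.Sphere} (hr : K.OneFormRel r) :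
    F.univRep h r = 0 := by
  cases hr with
  | chain f =>
    simp [univRep_of, univRep_δ, der_fn, deriv_t, X_fn, Algebra.smul_def]
  | dt_central y => simp [univRep_of, univRep_δ, der_t, X_τ]
  | t_comm i => simp [univRep_of, univRep_δ, X_fn, Algebra.commutes]
  | x_dx i j =>
    simp only [map_sub, map_add, map_mul, map_smul, univRep_of, univRep_δ, der_x, der_t, X_fn]
    rw [F.x_dx i j, β, smul_assoc, Algebra.smul_def (K.A i j), Algebra.smul_def (K.B i j), mul_assoc,
      mul_assoc, sub_self]
  | sphere =>
    simp only [map_add, map_mul, map_smul, univRep_of, univRep_δ, der_x, der_t, X_fn]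
    rw [← F.sphere_relation h, two_smul, ← Algebra.smul_def, add_smul]

/-- No differential is given on R, so the relations from d J¹ need a separate check. The essential
case is that of x^i dx^j, where the differential of the relation is `dx_dx`. -/
theorem univRep_d_oneFormRel (h : F.radial = 0) {r : Univ K.Sphere} (hr : K.OneFormRel r) :
    F.univRep h (Univ.d r) = 0 := by
  cases hr with
  | chain f =>
    simp [Univ.d_mul, Univ.d_of, Univ.d_δ, univRep_δ, der_fn, F.τ_τ]
  | dt_central y =>
    simp [Univ.d_mul, Univ.d_of, Univ.d_δ, Univ.sgn_δ, univRep_δ, der_t, der_τ]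
  | t_comm i =>
    simp [Univ.d_mul, Univ.d_of, Univ.d_δ, Univ.sgn_δ, univRep_δ, der_t, τ_der]
  | x_dx i j =>
    have h1 : K.A i j • (F.τ * (F.dx j * F.x i)) = F.τ * (F.x i * F.dx j) := by
      rw [F.x_dx i j, mul_add, mul_smul_comm, mul_smul_comm, τ_mul_τ_mul, smul_zero, add_zero]
    have h2 : ∀ r : R, (1 / 2 : ℂ) • (K.B i j • r) = K.β i j • r := fun r => by
      rw [β, smul_assoc]
    simp only [map_sub, map_add, map_mul, map_smul, Univ.d_mul, Univ.d_of, Univ.d_δ, Univ.sgn_of,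
      Univ.sgn_δ, univRep_of, univRep_δ, der_x, der_fn, der_mul, X_fn, mul_zero,
      add_zero, map_neg, deriv_t, one_smul, zero_mul, zero_add, neg_mul, mul_neg,
      smul_mul_assoc, ← Algebra.smul_def, mul_assoc]
    simp only [F.τ_mul_τ_mul, smul_zero, zero_add, ← smul_neg, h2]
    rw [deriv_A, mul_smul, h1, F.dx_dx i j, ← β_add_β, mul_sub, mul_add]
    module
  | sphere =>
    have h1 : F.dx 1 * F.dx 0 = -(F.dx 0 * F.dx 1) := by
      rw [F.dx_dx 1 0]
      simp [A, β, B, deriv_one]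
    have h2 : F.dx 3 * F.dx 2 = -(F.dx 2 * F.dx 3) := by
      rw [F.dx_dx 3 2]
      simp [A, β, B, deriv_one]
    simp only [map_add, map_mul, map_smul, Univ.d_mul, Univ.d_of, Univ.d_δ, Univ.sgn_of, mul_zero,
      add_zero, univRep_δ, der_x, der_t, F.τ_τ, smul_zero, h1, h2]
    abel

/-- By d(y r z) = dy r z + y dr z − y r dz it is enough that r and dr are sent to zero. -/
theorem univRep_mem_J (h : F.radial = 0) {w : Univ K.Sphere} (hw : w ∈ K.J) :
    F.univRep h w = 0 ∧ F.univRep h (Univ.d w) = 0 := by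
  induction hw using Submodule.span_induction with
  | mem w hw =>
    obtain ⟨y, z, r, hr, rfl⟩ := hw
    simp [Univ.d_mul, Univ.sgn_mul, K.sgn_of_oneFormRel hr, F.univRep_oneFormRel h hr,
      F.univRep_d_oneFormRel h hr]
  | zero => simp
  | add v w _ _ hv hw => simp [hv, hw]
  | smul c w _ hw => simp [hw]

/-- The representation of the differential algebra of the sphere. -/
noncomputable def rep (h : F.radial = 0) : K.Forms →ₐ[ℂ] R :=
  RingQuot.liftAlgHom ℂ ⟨F.univRep h, by
    intro p q hpq
    cases hpq with
    | zero w hw => rw [(F.univRep_mem_J h hw).1, map_zero]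
    | d_zero w hw => rw [(F.univRep_mem_J h hw).2, map_zero]⟩

theorem rep_form (h : F.radial = 0) (y : K.Sphere) : F.rep h (K.form y) = F.X y :=
  (RingQuot.liftAlgHom_mkAlgHom_apply ℂ _ _ _).trans (F.univRep_of h y)

theorem rep_dform (h : F.radial = 0) (y : K.Sphere) : F.rep h (K.dform y) = F.der h y :=
  (RingQuot.liftAlgHom_mkAlgHom_apply ℂ _ _ _).trans (F.univRep_δ h y)

theorem rep_dx (h : F.radial = 0) (i : Fin 4) : F.rep h (K.dx i) = F.dx i := by
  rw [rep_dform, der_x]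

theorem rep_dt (h : F.radial = 0) : F.rep h K.dt = F.τ := by
  rw [rep_dform, der_t]

end Frame

end Coeff

end DynSphere

namespace DynSphere

/-! ### Twisted creation operators -/

theorem end_mul_neg {k N : Type*} [CommRing k] [AddCommGroup N] [Module k N]
    (a b : Module.End k N) : a * -b = -(a * b) :=
  LinearMap.ext fun F => map_neg a (b F)

section Creation

variable {ι k M : Type*} [LinearOrder ι] [CommRing k] [AddCommGroup M] [Module k M]

/-- Left multiplication by the `i`-th generator of the exterior algebra twisted by `q`, in
coordinates with respect to the ordered monomials. -/
def creation (q : ι → ι → k) (i : ι) : Module.End k (Finset ι → M) where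
  toFun F I := if i ∈ I then (∏ j ∈ I with j < i, -q i j) • F (I.erase i) else 0
  map_add' F G := by
    ext I
    by_cases h : i ∈ I <;> simp [h]
  map_smul' c F := by
    ext I
    by_cases h : i ∈ I <;> simp [h, smul_comm c]

variable (q : ι → ι → k)

theorem creation_apply (i : ι) (F : Finset ι → M) (I : Finset ι) :
    creation q i F I = if i ∈ I then (∏ j ∈ I with j < i, -q i j) • F (I.erase i) else 0 := rfl

theorem creation_mul_self (i : ι) : creation (M := M) q i * creation q i = 0 := by
  ext F I
  simp [Module.End.mul_apply, creation_apply]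

/-- The two orders give the same product of factors, except that the larger letter j, when inserted
last, also passes i and picks up −q_ji. -/
theorem creation_mul_of_lt {i j : ι} (h : i < j) :
    creation (M := M) q j * creation q i = -(q j i • (creation q i * creation q j)) := by
  refine LinearMap.ext fun F => funext fun I => ?_
  simp only [Module.End.mul_apply, LinearMap.neg_apply, LinearMap.smul_apply, Pi.neg_apply,
    Pi.smul_apply, creation_apply]
  by_cases hi : i ∈ I
  · by_cases hj : j ∈ I
    · have h1 : ((I.erase j).filter (· < i)) = I.filter (· < i) := by
        ext l
        simp only [Finset.mem_filter, Finset.mem_erase]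
        exact ⟨fun h => ⟨h.1.2, h.2⟩, fun hl => ⟨⟨(hl.2.trans h).ne, hl.1⟩, hl.2⟩⟩
      have h2 : I.filter (· < j) = insert i ((I.erase i).filter (· < j)) := by
        ext l
        simp only [Finset.mem_filter, Finset.mem_erase, Finset.mem_insert]
        by_cases hl : l = i <;> simp [hl, hi, h]
      rw [if_pos hj, if_pos hi, if_pos (Finset.mem_erase.mpr ⟨h.ne, hi⟩),
        if_pos (Finset.mem_erase.mpr ⟨h.ne', hj⟩), h1, h2, Finset.prod_insert (by simp),
        Finset.erase_right_comm, smul_smul, smul_smul, smul_smul, ← neg_smul]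
      congr 1
      ring
    · simp [hj]
  · simp [hi]

theorem creation_mul (hq : ∀ i j, q i j * q j i = 1) {i j : ι} (h : i ≠ j) :
    creation (M := M) q i * creation q j = -(q i j • (creation q j * creation q i)) := by
  rcases lt_or_gt_of_ne h with h | h
  · rw [creation_mul_of_lt q h, smul_neg, smul_smul, hq, one_smul, neg_neg]
  · exact creation_mul_of_lt q h

theorem creation_compLeft (i : ι) (f : M →ₗ[k] M) :
    creation q i * f.compLeft (Finset ι) = f.compLeft (Finset ι) * creation q i := by
  refine LinearMap.ext fun F => funext fun I => ?_
  simp only [Module.End.mul_apply, LinearMap.compLeft_apply, Function.comp_apply, creation_apply]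
  split_ifs
  · rw [map_smul]
  · rw [map_zero]

end Creation

namespace Coeff

variable {φ : ℝ → ℝ} {hφ : ContDiffOn ℝ ∞ φ (Set.Icc (-1) 1)} (K : Coeff φ hφ)

/-! ### Automorphisms and weight derivations of the sphere algebra -/

/-- The endomorphism `x^i ↦ A_{ji} x^i`. -/
noncomputable def twist (j : Fin 4) : K.Sphere →ₐ[K.Fun] K.Sphere :=
  K.sphereLift (fun i => K.A j i • K.x i)
    (fun i k => by
      rw [smul_mul_smul_comm, smul_mul_smul_comm, x_mul_x, smul_smul, smul_smul]
      congr 1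
      ring)
    (by
      have h1 : K.A j 0 * K.A j 1 = 1 := by
        rw [← K.A_mul_A j 0]
        exact congrArg _ (K.A_conj_right j 0)
      have h2 : K.A j 2 * K.A j 3 = 1 := by
        rw [← K.A_mul_A j 2]
        exact congrArg _ (K.A_conj_right j 2)
      rw [smul_mul_smul_comm, smul_mul_smul_comm, h1, h2, one_smul, one_smul]
      exact K.sphere_eq)

theorem twist_x (j i : Fin 4) : K.twist j (K.x i) = K.A j i • K.x i := K.sphereLift_x _ _ _ _

/-- The algebra map `y ↦ y + ε N_j y`, where `N_j` is the derivation `x^i ↦ β_{ji} x^i`. -/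
noncomputable def weightLift (j : Fin 4) : K.Sphere →ₐ[K.Fun] DualNumber K.Sphere :=
  K.sphereLift (fun i => TrivSqZeroExt.inl (K.x i) + TrivSqZeroExt.inr (K.β j i • K.x i))
    (fun i k => by
      ext
      · simpa using K.x_mul_x i k
      · simp [smul_add, K.x_mul_x i k, smul_comm (K.A i k), add_comm])
    (by
      -- Adjoint generators have opposite weights, so aa* and bb* have weight zero and the sphere
      -- relation survives in the ε-part.
      have h1 : K.β j 1 = -K.β j 0 := K.β_conj_right j 0
      have h2 : K.β j 3 = -K.β j 2 := K.β_conj_right j 2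
      ext
      · simpa [TrivSqZeroExt.algebraMap_eq_inl', fn] using K.sphere_eq
      · simp [TrivSqZeroExt.algebraMap_eq_inl', h1, h2])

/-- The derivation `x^i ↦ β_{ji} x^i`. -/
noncomputable def weight (j : Fin 4) : K.Sphere →ₗ[K.Fun] K.Sphere :=
  (TrivSqZeroExt.sndHom K.Sphere K.Sphere).restrictScalars K.Fun ∘ₗ (K.weightLift j).toLinearMap

theorem weight_apply (j : Fin 4) (y : K.Sphere) : K.weight j y = (K.weightLift j y).snd := rfl

theorem weight_x (j i : Fin 4) : K.weight j (K.x i) = K.β j i • K.x i := by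
  rw [weight_apply, weightLift, sphereLift_x]
  simp

theorem weightLift_fst (j : Fin 4) (y : K.Sphere) : (K.weightLift j y).fst = y := by
  induction y using K.sphere_induction with
  | hfn f =>
    rw [fn, AlgHom.commutes]
    simp [TrivSqZeroExt.algebraMap_eq_inl']
  | hx i =>
    rw [weightLift, sphereLift_x]
    simp
  | hadd y z hy hz => rw [map_add, TrivSqZeroExt.fst_add, hy, hz]
  | hmul y z hy hz => rw [map_mul, TrivSqZeroExt.fst_mul, hy, hz]

theorem weight_mul (j : Fin 4) (y z : K.Sphere) :
    K.weight j (y * z) = y * K.weight j z + K.weight j y * z := by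
  rw [weight_apply, map_mul, TrivSqZeroExt.snd_mul, weightLift_fst, weightLift_fst]
  rfl

theorem weight_fn (j : Fin 4) (f : K.Fun) : K.weight j (K.fn f) = 0 := by
  rw [weight_apply, fn, AlgHom.commutes]
  simp [TrivSqZeroExt.algebraMap_eq_inl']

theorem weight_one (j : Fin 4) : K.weight j 1 = 0 := by
  rw [← map_one K.fn, weight_fn]

theorem twist_twist (i j : Fin 4) (y : K.Sphere) :
    K.twist i (K.twist j y) = K.twist j (K.twist i y) := by
  induction y using K.sphere_induction with
  | hfn f => simp only [fn, AlgHom.commutes]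
  | hx k => simp only [twist_x, map_smul, smul_comm (K.A i k)]
  | hadd y z hy hz => simp only [map_add, hy, hz]
  | hmul y z hy hz => simp only [map_mul, hy, hz]

theorem weight_twist (i j : Fin 4) (y : K.Sphere) :
    K.weight i (K.twist j y) = K.twist j (K.weight i y) := by
  induction y using K.sphere_induction with
  | hfn f => rw [weight_fn, map_zero, fn, AlgHom.commutes, ← fn, weight_fn]
  | hx k => simp only [twist_x, weight_x, map_smul, smul_comm (K.A j k)]
  | hadd y z hy hz => simp only [map_add, hy, hz]
  | hmul y z hy hz => simp only [map_mul, weight_mul, map_add, hy, hz]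

theorem weight_conj (j : Fin 4) (y : K.Sphere) : K.weight (conj j) y = -K.weight j y := by
  induction y using K.sphere_induction with
  | hfn f => rw [weight_fn, weight_fn, neg_zero]
  | hx i => rw [weight_x, weight_x, β_conj_left, neg_smul]
  | hadd y z hy hz => rw [map_add, map_add, hy, hz, neg_add]
  | hmul y z hy hz => rw [weight_mul, weight_mul, hy, hz, mul_neg, neg_mul, neg_add]

/-! ### The frame on the twisted exterior algebra -/

/-- The commutation factors of `dt, dx^0, …, dx^3`. -/
noncomputable def extA : Fin 5 → Fin 5 → K.Fun :=
  Fin.cons (fun _ => 1) fun i => Fin.cons 1 fun j => K.A i j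

theorem extA_mul (i j : Fin 5) : K.extA i j * K.extA j i = 1 := by
  refine Fin.cases ?_ (fun i => ?_) i <;> refine Fin.cases ?_ (fun j => ?_) j <;>
    simp [extA, A_mul_A]

/-- The weights of `dt, dx^0, …, dx^3`. -/
noncomputable def extWeight (j : Fin 4) : Fin 5 → K.Fun := Fin.cons 0 fun i => K.β j i

/-- The weight operators on the twisted exterior algebra. -/
noncomputable def totalWeight (j : Fin 4) : Module.End K.Fun (Finset (Fin 5) → K.Sphere) where
  toFun F I := K.weight j (F I) + (∑ i ∈ I, K.extWeight j i) • F I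
  map_add' F G := by
    ext I
    simp only [Pi.add_apply, map_add, smul_add]
    abel
  map_smul' c F := by
    ext I
    simp only [Pi.smul_apply, map_smul, smul_add, RingHom.id_apply, smul_comm c]

theorem totalWeight_apply (j : Fin 4) (F : Finset (Fin 5) → K.Sphere) (I : Finset (Fin 5)) :
    K.totalWeight j F I = K.weight j (F I) + (∑ i ∈ I, K.extWeight j i) • F I := rfl

theorem totalWeight_creation (j : Fin 4) (i : Fin 5) :
    K.totalWeight j * creation K.extA i =
      creation K.extA i * K.totalWeight j + K.extWeight j i • creation K.extA i := by
  refine LinearMap.ext fun F => funext fun I => ?_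
  simp only [Module.End.mul_apply, LinearMap.add_apply, LinearMap.smul_apply, Pi.add_apply,
    Pi.smul_apply, creation_apply, totalWeight_apply]
  by_cases h : i ∈ I
  · simp only [if_pos h, map_smul]
    rw [← Finset.add_sum_erase I _ h]
    module
  · simp [h]

/-- The twist as an operator on the twisted exterior algebra. -/
noncomputable def twistOp (j : Fin 4) : Module.End K.Fun (Finset (Fin 5) → K.Sphere) :=
  (K.twist j).toLinearMap.compLeft _

theorem twistOp_apply (j : Fin 4) (F : Finset (Fin 5) → K.Sphere) (I : Finset (Fin 5)) :
    K.twistOp j F I = K.twist j (F I) := rfl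

theorem creation_twistOp (i : Fin 5) (j : Fin 4) :
    creation K.extA i * K.twistOp j = K.twistOp j * creation K.extA i :=
  creation_compLeft _ _ _

theorem twistOp_twistOp (i j : Fin 4) :
    K.twistOp i * K.twistOp j = K.twistOp j * K.twistOp i :=
  LinearMap.ext fun _ => funext fun _ => K.twist_twist i j _

theorem totalWeight_twistOp (i j : Fin 4) :
    K.totalWeight i * K.twistOp j = K.twistOp j * K.totalWeight i := by
  refine LinearMap.ext fun F => funext fun I => ?_
  simp only [Module.End.mul_apply, totalWeight_apply, twistOp_apply, map_add, map_smul,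
    weight_twist]

/-- Left multiplication on the twisted exterior algebra. -/
noncomputable def leftMul : K.Sphere →ₐ[K.Fun] Module.End K.Fun (Finset (Fin 5) → K.Sphere) :=
  Algebra.lsmul K.Fun K.Fun (Finset (Fin 5) → K.Sphere)

theorem leftMul_apply (y : K.Sphere) (F : Finset (Fin 5) → K.Sphere) (I : Finset (Fin 5)) :
    K.leftMul y F I = y * F I := rfl

theorem creation_leftMul (i : Fin 5) (y : K.Sphere) :
    creation K.extA i * K.leftMul y = K.leftMul y * creation K.extA i :=
  creation_compLeft K.extA i (LinearMap.mulLeft K.Fun y)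

/-- Creation operators commute with left multiplication; composing them with the twist supplies the
factors A_ij required of θ. -/
theorem leftMul_twistOp (i j : Fin 4) :
    K.leftMul (K.x i) * K.twistOp j = K.A i j • (K.twistOp j * K.leftMul (K.x i)) := by
  refine LinearMap.ext fun F => funext fun I => ?_
  simp only [Module.End.mul_apply, LinearMap.smul_apply, Pi.smul_apply, twistOp_apply,
    leftMul_apply, map_mul, twist_x, smul_mul_assoc, smul_smul, A_mul_A, one_smul]

/-- The frame on the twisted exterior algebra. -/
noncomputable def frame : K.Frame (Module.End K.Fun (Finset (Fin 5) → K.Sphere)) where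
  X := K.leftMul
  θ j := K.twistOp j * creation K.extA j.succ
  τ := creation K.extA 0
  ν := K.totalWeight
  X_θ i j := by
    rw [mul_assoc, creation_leftMul, ← mul_assoc, leftMul_twistOp, smul_mul_assoc, mul_assoc]
  X_τ y := (K.creation_leftMul 0 y).symm
  θ_θ i j := by
    have h : creation K.extA i.succ * creation K.extA j.succ =
        -(K.A i j • (creation (M := K.Sphere) K.extA j.succ * creation K.extA i.succ)) := by
      by_cases hij : i = j
      · subst hij
        rw [creation_mul_self, smul_zero, neg_zero]
      · exact creation_mul K.extA K.extA_mul fun h => hij (Fin.succ_injective _ h)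
    rw [mul_assoc, ← mul_assoc (creation K.extA i.succ), creation_twistOp, mul_assoc, h,
      mul_assoc, ← mul_assoc (creation K.extA j.succ), creation_twistOp, mul_assoc, ← mul_assoc,
      twistOp_twistOp, end_mul_neg, mul_smul_comm, mul_assoc]
  θ_τ i := by
    rw [mul_assoc, creation_mul _ K.extA_mul (Fin.succ_ne_zero i), ← mul_assoc, creation_twistOp,
      end_mul_neg, mul_smul_comm, mul_assoc]
    have h : K.extA i.succ 0 = 1 := rfl
    rw [h, one_smul]
  τ_τ := creation_mul_self _ _
  ν_X j i := by
    refine LinearMap.ext fun F => funext fun I => ?_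
    simp only [Module.End.mul_apply, LinearMap.smul_apply, Pi.smul_apply, leftMul_apply,
      totalWeight_apply, weight_mul, LinearMap.add_apply, Pi.add_apply, weight_x, mul_add,
      mul_smul_comm, smul_mul_assoc]
    abel
  ν_θ j i := by
    rw [← mul_assoc, totalWeight_twistOp, mul_assoc, totalWeight_creation, mul_add, mul_assoc,
      mul_smul_comm]
    rfl
  ν_τ j := by
    rw [totalWeight_creation]
    simp [extWeight]
  ν_conj j := by
    have h : ∀ i, K.extWeight (conj j) i = -K.extWeight j i := by
      intro i
      refine Fin.cases ?_ (fun i => ?_) i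
      · simp [extWeight]
      · simp [extWeight, β_conj_left]
    refine LinearMap.ext fun F => funext fun I => ?_
    simp only [LinearMap.neg_apply, Pi.neg_apply, totalWeight_apply, weight_conj, h,
      Finset.sum_neg_distrib, neg_smul, neg_add]

/-- The unit of the twisted exterior algebra. -/
noncomputable def vac : Finset (Fin 5) → K.Sphere := Pi.single ∅ 1

theorem totalWeight_vac (j : Fin 4) : K.totalWeight j K.vac = 0 := by
  refine funext fun I => ?_
  rw [totalWeight_apply, vac]
  by_cases h : I = ∅
  · subst h
    simp [weight_one]
  · simp [Pi.single_eq_of_ne h]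

theorem twistOp_vac (j : Fin 4) : K.twistOp j K.vac = K.vac := by
  refine funext fun I => ?_
  rw [twistOp_apply, vac]
  by_cases h : I = ∅
  · subst h
    simp
  · simp [Pi.single_eq_of_ne h]

theorem creation_apply_of_forall_le {i : Fin 5} {I : Finset (Fin 5)} (h : i ∈ I)
    (h' : ∀ j ∈ I, i ≤ j) (F : Finset (Fin 5) → K.Sphere) :
    creation K.extA i F I = F (I.erase i) := by
  rw [creation_apply, if_pos h, Finset.filter_false_of_mem fun j hj => (h' j hj).not_gt,
    Finset.prod_empty, one_smul]

theorem twistOp_creation_apply (i : Fin 5) (j : Fin 4) (F : Finset (Fin 5) → K.Sphere) :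
    K.twistOp j (creation K.extA i F) = creation K.extA i (K.twistOp j F) :=
  LinearMap.congr_fun (K.creation_twistOp i j).symm F

theorem frame_τ : K.frame.τ = creation K.extA 0 := rfl

theorem frame_θ (j : Fin 4) : K.frame.θ j = K.twistOp j * creation K.extA j.succ := rfl

/-- The letters are created in decreasing order, so each is the least of its index set and no
commutation factor arises. -/
theorem top_apply : (K.frame.τ * (K.frame.θ 0 * (K.frame.θ 1 * (K.frame.θ 2 * K.frame.θ 3))))
    K.vac Finset.univ = 1 := by
  rw [frame_τ, frame_θ, frame_θ, frame_θ, frame_θ]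
  simp only [Module.End.mul_apply, twistOp_creation_apply, twistOp_vac]
  rw [creation_apply_of_forall_le _ (by decide) (by decide),
    creation_apply_of_forall_le _ (by decide) (by decide),
    creation_apply_of_forall_le _ (by decide) (by decide),
    creation_apply_of_forall_le _ (by decide) (by decide),
    creation_apply_of_forall_le _ (by decide) (by decide)]
  have h : (((((Finset.univ : Finset (Fin 5)).erase 0).erase (Fin.succ 0)).erase (Fin.succ 1)).erase
      (Fin.succ 2)).erase (Fin.succ 3) = ∅ := by
    decide
  rw [h, vac, Pi.single_eq_same]

end Coeff

end DynSphere

namespace DynSphere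

namespace Coeff

variable {φ : ℝ → ℝ} {hφ : ContDiffOn ℝ ∞ φ (Set.Icc (-1) 1)} {K : Coeff φ hφ}

namespace Frame

variable {R : Type*} [Ring R] [Algebra K.Fun R] (F : K.Frame R)

/-! ### The top form -/

theorem radial_dx (i : Fin 4) : F.radial * F.dx i = -(F.dx i * F.radial) := by
  have h : F.τ * (F.x i * F.ν i) * F.radial = -(F.radial * (F.τ * (F.x i * F.ν i))) := by
    rw [mul_assoc, mul_assoc, ν_radial, ← mul_assoc (F.x i), X_radial, mul_assoc, ← mul_assoc,
      τ_radial, neg_mul, mul_assoc]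
  rw [dx, add_mul, mul_add, h, θ_radial, neg_add, neg_neg, neg_neg]

/-- The projection changes one-forms by multiples of ρ, which ρ annihilates from the left. -/
theorem radial_mul_tangent_dx_mul (i : Fin 4) (r : R) :
    F.radial * (F.tangent.dx i * r) = -(F.dx i * (F.radial * r)) := by
  have h1 : F.radial * F.tangent.dx i = F.radial * F.dx i := by
    change F.radial * ((F.θ i - F.x i * F.radial) +
      (F.τ - K.t • F.radial) * (F.x i * F.ν i)) = _
    rw [dx, sub_mul, mul_add, mul_add, mul_sub, mul_sub, ← mul_assoc F.radial (F.x i), ← X_radial,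
      mul_assoc (F.x i), radial_radial, mul_zero, sub_zero, smul_mul_assoc, mul_smul_comm,
      ← mul_assoc F.radial F.radial, radial_radial, zero_mul, smul_zero, sub_zero]
  rw [← mul_assoc, h1, radial_dx, neg_mul, mul_assoc]

theorem radial_mul_tangent_τ_mul (r : R) :
    F.radial * (F.tangent.τ * r) = -(F.τ * (F.radial * r)) := by
  have h1 : F.radial * F.tangent.τ = F.radial * F.τ := by
    change F.radial * (F.τ - K.t • F.radial) = _
    rw [mul_sub, mul_smul_comm, radial_radial, smul_zero, sub_zero]
  rw [← mul_assoc, h1, ← neg_neg (F.radial * _), ← τ_radial, neg_mul, mul_assoc]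

theorem τ_dx_mul (i : Fin 4) (r : R) : F.τ * (F.dx i * r) = F.τ * (F.θ i * r) := by
  rw [dx, add_mul, mul_add, mul_assoc F.τ, τ_mul_τ_mul, add_zero]

theorem τ_θ_mul (i : Fin 4) (r : R) : F.τ * (F.θ i * r) = -(F.θ i * (F.τ * r)) := by
  rw [← mul_assoc (F.θ i), θ_τ, neg_mul, neg_neg, mul_assoc]

theorem θ_θ_mul (i j : Fin 4) (r : R) :
    F.θ i * (F.θ j * r) = -(K.A i j • (F.θ j * (F.θ i * r))) := by
  rw [← mul_assoc, θ_θ, neg_mul, smul_mul_assoc, mul_assoc]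

theorem θ_self (i : Fin 4) : F.θ i * F.θ i = 0 :=
  K.eq_zero_of_eq_neg (by simpa [A_self] using F.θ_θ i i)

theorem θ_self_mul (i : Fin 4) (r : R) : F.θ i * (F.θ i * r) = 0 := by
  rw [← mul_assoc, θ_self, zero_mul]

theorem radial_θ_mul (i : Fin 4) (r : R) :
    F.radial * (F.θ i * r) = -(F.θ i * (F.radial * r)) := by
  rw [← mul_assoc (F.θ i), θ_radial, neg_mul, neg_neg, mul_assoc]

theorem radial_τ_mul (r : R) : F.radial * (F.τ * r) = -(F.τ * (F.radial * r)) := by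
  rw [← mul_assoc F.τ, τ_radial, neg_mul, neg_neg, mul_assoc]

theorem radial_mul_tangent_dx (k : Fin 4) :
    F.radial * F.tangent.dx k = -(F.dx k * F.radial) := by
  simpa using F.radial_mul_tangent_dx_mul k 1

/-- Multiplying by ρ removes the projection, and the leading τ removes the weight corrections,
leaving the flat word. -/
theorem radial_mul_τ_dx_dx_dx (i j k : Fin 4) :
    F.radial * (F.tangent.τ * (F.tangent.dx i * (F.tangent.dx j * F.tangent.dx k))) =
      F.radial * (F.τ * (F.θ i * (F.θ j * F.θ k))) := by
  have h : F.radial * F.θ k = -(F.θ k * F.radial) := by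
    rw [θ_radial, neg_neg]
  rw [radial_mul_tangent_τ_mul, radial_mul_tangent_dx_mul, radial_mul_tangent_dx_mul,
    radial_mul_tangent_dx, radial_τ_mul, radial_θ_mul, radial_θ_mul, h]
  simp only [mul_neg, neg_neg]
  rw [τ_dx_mul, τ_θ_mul, τ_dx_mul, τ_θ_mul, τ_dx_mul, ← τ_θ_mul, ← τ_θ_mul]

/-- The form `dt dx^0 dx^1 dx^2 dx^3`. -/
noncomputable def top : R := F.τ * (F.θ 0 * (F.θ 1 * (F.θ 2 * F.θ 3)))

theorem radial_mul (r : R) : F.radial * r =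
    K.half • (F.x 0 * (F.θ 1 * r) + F.x 1 * (F.θ 0 * r) + F.x 2 * (F.θ 3 * r)
      + F.x 3 * (F.θ 2 * r)) + K.t • (F.τ * r) := by
  rw [radial, add_mul, smul_mul_assoc, smul_mul_assoc, Fin.sum_univ_four]
  simp only [← mul_assoc, ← add_mul]
  rfl

theorem θ_τ_mul (i : Fin 4) (r : R) : F.θ i * (F.τ * r) = -(F.τ * (F.θ i * r)) := by
  rw [← mul_assoc, θ_τ, neg_mul, mul_assoc]

/-- Only the summand ½ x^0 θ^1 of ρ carries a letter missing from the word. In the next two lemmas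
the surviving summands are ½ x^2 θ^3 and tτ. -/
theorem radial_mul_word_two : F.radial * (F.τ * (F.θ 0 * (F.θ 2 * F.θ 3))) =
    K.half • (F.x 0 * F.top) := by
  have hA : K.A 1 0 = 1 := rfl
  rw [radial_mul, top]
  simp only [θ_τ_mul, F.θ_θ_mul 1 0, F.θ_θ_mul 2 0, F.θ_θ_mul 3 0, F.θ_θ_mul 3 2, θ_self_mul,
    θ_self, mul_zero, smul_zero, neg_zero, add_zero, hA, one_smul, mul_neg, neg_neg, τ_mul_τ_mul]

theorem radial_mul_word_zero : F.radial * (F.τ * (F.θ 0 * (F.θ 1 * F.θ 2))) =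
    K.half • (F.x 2 * F.top) := by
  have hA : K.A 3 2 = 1 := rfl
  have hA' : K.A 3 0 * K.A 3 1 = 1 := by
    rw [← K.A_mul_A 3 0]
    exact congrArg _ (K.A_conj_right 3 0)
  rw [radial_mul, top]
  simp only [θ_τ_mul, F.θ_θ_mul 1 0, F.θ_θ_mul 2 0, F.θ_θ_mul 3 0, F.θ_θ_mul 2 1, F.θ_θ_mul 3 1,
    F.θ_θ 3 2, θ_self_mul, θ_self, mul_zero, smul_zero, neg_zero, add_zero, zero_add, hA, hA',
    one_smul, mul_neg, neg_neg, τ_mul_τ_mul, mul_smul_comm, smul_smul, smul_neg]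

theorem radial_mul_areas : F.radial * (F.θ 0 * (F.θ 1 * (F.θ 2 * F.θ 3))) = K.t • F.top := by
  rw [radial_mul, top]
  simp only [F.θ_θ_mul 1 0, F.θ_θ_mul 2 0, F.θ_θ_mul 3 0, F.θ_θ_mul 2 1, F.θ_θ_mul 3 1,
    F.θ_θ_mul 3 2, θ_self_mul, θ_self, mul_zero, smul_zero, neg_zero, add_zero, zero_add]

theorem radial_mul_dx_dx_dx_dx (i j k l : Fin 4) :
    F.radial * (F.tangent.dx i * (F.tangent.dx j * (F.tangent.dx k * F.tangent.dx l))) =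
      F.radial * (F.dx i * (F.dx j * (F.dx k * F.dx l))) := by
  have h : ∀ i r, F.radial * (F.dx i * r) = -(F.dx i * (F.radial * r)) := fun i r => by
    rw [← mul_assoc, radial_dx, neg_mul, mul_assoc]
  rw [radial_mul_tangent_dx_mul, radial_mul_tangent_dx_mul, radial_mul_tangent_dx_mul,
    radial_mul_tangent_dx, h, h, h, radial_dx]

theorem ν_θ_mul (j i : Fin 4) (r : R) :
    F.ν j * (F.θ i * r) = F.θ i * (F.ν j * r) + K.β j i • (F.θ i * r) := by
  rw [← mul_assoc, ν_θ, add_mul, mul_assoc, smul_mul_assoc]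

/-- Each ν_j meets a word of weight zero applied to v: the weights β_23, β_12 + β_13 and β_01 + β_02
+ β_03 all vanish. So no correction survives. -/
theorem areas_smul {M : Type*} [AddCommGroup M] [Module R M] {v : M} (hv : ∀ j, F.ν j • v = 0) :
    (F.dx 0 * (F.dx 1 * (F.dx 2 * F.dx 3))) • v =
      (F.θ 0 * (F.θ 1 * (F.θ 2 * F.θ 3))) • v := by
  have h : ∀ (j : Fin 4) (r : R), F.ν j * r = r * F.ν j → F.dx j • r • v = F.θ j • r • v := by
    intro j r hr
    rw [dx, add_smul, mul_smul F.τ, mul_smul (F.x j), ← mul_smul (F.ν j), hr, mul_smul r, hv,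
      smul_zero, smul_zero, smul_zero, add_zero]
  have h3 : F.dx 3 • v = F.θ 3 • v := by
    simpa using h 3 1 (by rw [mul_one, one_mul])
  have h23 : K.β 2 3 = 0 := K.β_conj_self 2
  have h01 : K.β 0 1 = 0 := K.β_conj_self 0
  have h12 : K.β 1 3 = -K.β 1 2 := K.β_conj_right 1 2
  have h02 : K.β 0 3 = -K.β 0 2 := K.β_conj_right 0 2
  rw [mul_smul, mul_smul, mul_smul, h3, h 2, ← mul_smul (F.θ 2), h 1, ← mul_smul (F.θ 1), h 0,
    ← mul_smul]
  · rw [ν_θ_mul, ν_θ_mul, ν_θ, h01, h02, zero_smul, add_zero, mul_assoc, mul_assoc, mul_add, mul_add,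
      mul_add, mul_smul_comm, neg_smul]
    simp
  · rw [ν_θ_mul, ν_θ, h12, mul_assoc, mul_add]
    simp
  · rw [ν_θ, h23, zero_smul, add_zero]

theorem X_mul_radial_mul {y : K.Sphere} {r : R} (h : F.X y * r = 0) :
    F.X y * (F.radial * r) = 0 := by
  rw [← mul_assoc, X_radial, mul_assoc, h, mul_zero]

theorem X_mul_top_of_half_smul {y : K.Sphere} {i : Fin 4}
    (h : F.X y * (K.half • (F.x i * F.top)) = 0) : F.X (y * K.x i) * F.top = 0 := by
  rw [map_mul, mul_assoc, ← one_smul K.Fun (F.X y * _), ← half_add_half, add_smul,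
    ← mul_smul_comm, h, add_zero]

theorem X_mul_x_zero_mul_top {y : K.Sphere}
    (h : F.X y * (F.tangent.τ * (F.tangent.dx 0 * (F.tangent.dx 2 * F.tangent.dx 3))) = 0) :
    F.X (y * K.x 0) * F.top = 0 :=
  F.X_mul_top_of_half_smul <| by
    rw [← radial_mul_word_two, ← radial_mul_τ_dx_dx_dx]
    exact F.X_mul_radial_mul h

theorem X_mul_x_two_mul_top {y : K.Sphere}
    (h : F.X y * (F.tangent.τ * (F.tangent.dx 0 * (F.tangent.dx 1 * F.tangent.dx 2))) = 0) :
    F.X (y * K.x 2) * F.top = 0 :=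
  F.X_mul_top_of_half_smul <| by
    rw [← radial_mul_word_zero, ← radial_mul_τ_dx_dx_dx]
    exact F.X_mul_radial_mul h

/-- Here no τ stands in front to kill the weight corrections; evaluating at a vector of weight zero
does it instead. -/
theorem X_t_smul_mul_top {M : Type*} [AddCommGroup M] [Module R M] {v : M}
    (hv : ∀ j, F.ν j • v = 0) {y : K.Sphere}
    (h : F.X y * (F.tangent.dx 0 * (F.tangent.dx 1 * (F.tangent.dx 2 * F.tangent.dx 3))) = 0) :
    (F.X (K.t • y) * F.top) • v = 0 := by
  rw [map_smul, smul_mul_assoc, ← mul_smul_comm, ← radial_mul_areas, mul_smul, mul_smul,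
    ← F.areas_smul hv, ← mul_smul, ← mul_smul, mul_assoc, ← radial_mul_dx_dx_dx_dx]
  rw [F.X_mul_radial_mul h, zero_smul]

end Frame

/-! ### Faithfulness of multiplication on ω -/

variable (K)

theorem eq_zero_of_X_mul_top {y : K.Sphere} (h : (K.frame.X y * K.frame.top) • K.vac = 0) :
    y = 0 := by
  have h1 : (K.leftMul y * K.frame.top) K.vac Finset.univ = 0 := congrFun h _
  have h2 : (K.leftMul y * K.frame.top) K.vac Finset.univ = y * K.frame.top K.vac Finset.univ := rfl
  rwa [h2, Frame.top, top_apply, mul_one] at h1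

/-- The representation of the differential algebra on the twisted exterior algebra. -/
noncomputable def formRep : K.Forms →ₐ[ℂ] Module.End K.Fun (Finset (Fin 5) → K.Sphere) :=
  K.frame.tangent.rep K.frame.tangent_radial

theorem form_mul_eq_zero_of_smul {y : K.Sphere} {c d : ℂ} (hd : d ≠ 0) {v w : K.Forms}
    (h : c • v = d • w) (hv : K.form y * v = 0) : K.form y * w = 0 := by
  have h1 := congrArg (K.form y * ·) h
  simp only [mul_smul_comm, hv, smul_zero] at h1
  exact (smul_eq_zero_iff_right hd).mp h1.symm

theorem formRep_form_mul (y : K.Sphere) {w : K.Forms} (h : K.form y * w = 0) :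
    K.frame.X y * K.formRep w = 0 := by
  have h1 := congrArg K.formRep h
  rwa [map_mul, map_zero, formRep, Frame.rep_form] at h1

/-- Three of the product formulas suffice: in the representation they give ya = yb = ty = 0, and 1 =
aa* + bb* + t² lies in the right ideal generated by a, b and t. -/
theorem eq_zero_of_form_mul_vol {y : K.Sphere} (hy : K.form y * K.vol = 0) : y = 0 := by
  have h0 : y * K.x 0 = 0 := by
    have h := K.formRep_form_mul y (K.form_mul_eq_zero_of_smul two_ne_zero K.X_zero_mul_vol (by
      rw [X_mul_vol, ← mul_assoc, hy, zero_mul]))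
    rw [area_two, map_mul, map_mul, map_mul, formRep, Frame.rep_dt, Frame.rep_dx, Frame.rep_dx,
      Frame.rep_dx] at h
    refine K.eq_zero_of_X_mul_top ?_
    rw [K.frame.X_mul_x_zero_mul_top h, zero_smul]
  have h2 : y * K.x 2 = 0 := by
    have h := K.formRep_form_mul y (K.form_mul_eq_zero_of_smul two_ne_zero K.vol_mul_X_two (by
      rw [← mul_assoc, hy, zero_mul]))
    rw [area_zero, mul_assoc, map_mul, map_mul, map_mul, formRep, Frame.rep_dt, Frame.rep_dx,
      Frame.rep_dx, Frame.rep_dx] at h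
    refine K.eq_zero_of_X_mul_top ?_
    rw [K.frame.X_mul_x_two_mul_top h, zero_smul]
  have ht : K.t • y = 0 := by
    have h := K.formRep_form_mul y (K.form_mul_eq_zero_of_smul one_ne_zero
      (K.t_smul_vol.trans (one_smul ℂ _).symm) (by
        rw [mul_smul_comm, hy, smul_zero]))
    rw [area_zero, area_two, mul_assoc, map_mul, map_mul, map_mul, formRep, Frame.rep_dx,
      Frame.rep_dx, Frame.rep_dx, Frame.rep_dx] at h
    exact K.eq_zero_of_X_mul_top (K.frame.X_t_smul_mul_top K.totalWeight_vac h)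
  rw [← mul_one y, ← K.sphere_eq, mul_add, mul_add, ← mul_assoc, ← mul_assoc, h0, h2, fn,
    ← Algebra.commutes, ← Algebra.smul_def, sq, mul_smul, ht]
  simp

end Coeff

end DynSphere

theorem mainTheorem6 (φ : ℝ → ℝ) (hφ : ContDiffOn ℝ ∞ φ (Set.Icc (-1) 1))
    (K : DynSphere.Coeff φ hφ) :
    -- `y ↦ y ω = ω y` is an isomorphism of bimodules from the algebra to the four-forms
    (∃ e : K.Sphere ≃ₗ[ℂ] K.formsOfDegree 4,
      (e 1 : K.Forms) = K.vol ∧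
      ∀ x y z : K.Sphere, (e (x * y * z) : K.Forms) = K.form x * (e y : K.Forms) * K.form z) ∧
    -- `ω` is central
    (∀ y : K.Sphere, K.form y * K.vol = K.vol * K.form y) ∧
    -- the products of `ω` with the generators
    K.ft * K.vol = (1 / 4 : ℂ) • (K.da * K.da' * K.db * K.db') ∧
    K.fa * K.vol = (1 / 2 : ℂ) • (K.dt * K.da * K.db * K.db') ∧
    K.fa' * K.vol = -((1 / 2 : ℂ) • (K.dt * K.da' * K.db * K.db')) ∧
    K.vol * K.fb = (1 / 2 : ℂ) • (K.dt * K.da * K.da' * K.db) ∧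
    K.vol * K.fb' = -((1 / 2 : ℂ) • (K.dt * K.da * K.da' * K.db')) := by
  have h4 : ∀ v w : K.Forms, (4 : ℂ) • v = w → v = (1 / 4 : ℂ) • w := by
    rintro v _ rfl
    rw [smul_smul]
    norm_num
  have h42 : ∀ v w : K.Forms, (4 : ℂ) • v = (2 : ℂ) • w → v = (1 / 2 : ℂ) • w := by
    intro v w h
    rw [h4 v _ h, smul_smul]
    norm_num
  refine ⟨?_, K.form_mul_vol, ?_, ?_, ?_, ?_, ?_⟩
  · let f : K.Sphere →ₗ[ℂ] K.formsOfDegree 4 :=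
      ((LinearMap.mulRight ℂ K.vol).comp K.formHom.toLinearMap).codRestrict _ fun y =>
        K.form_mul_mem_formsOfDegree y K.vol_mem
    have hf : ∀ y, (f y : K.Forms) = K.form y * K.vol := fun y => rfl
    have hbij : Function.Bijective f := by
      constructor
      · refine (injective_iff_map_eq_zero f).mpr fun y hy => K.eq_zero_of_form_mul_vol ?_
        rw [← hf, hy]
        rfl
      · rintro ⟨w, hw⟩
        obtain ⟨y, hy⟩ := K.formsOfDegree_four_le hw
        exact ⟨y, Subtype.ext hy⟩
    refine ⟨LinearEquiv.ofBijective f hbij, ?_, fun x y z => ?_⟩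
    · rw [LinearEquiv.ofBijective_apply, hf, K.form_one, one_mul]
    · rw [LinearEquiv.ofBijective_apply, LinearEquiv.ofBijective_apply, hf, hf, K.form_mul,
        K.form_mul, mul_assoc, K.form_mul_vol z]
      simp only [mul_assoc]
  · have h := h4 _ _ K.t_smul_vol
    rw [K.area_zero, K.area_two, Algebra.smul_def, ← K.form_fn, ← mul_assoc] at h
    exact h
  · have h := h42 _ _ K.X_zero_mul_vol
    rw [K.area_two, ← mul_assoc, ← mul_assoc] at h
    exact h
  · have h := h42 (-(K.X 1 * K.vol)) (K.dt * (K.dx 1 * K.area 2)) (by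
      rw [smul_neg, K.X_one_mul_vol, neg_neg])
    rw [neg_eq_iff_eq_neg, K.area_two, ← mul_assoc, ← mul_assoc] at h
    exact h
  · have h := h42 _ _ K.vol_mul_X_two
    rw [K.area_zero, ← mul_assoc, ← mul_assoc] at h
    exact h
  · have h := h42 (-(K.vol * K.X 3)) (K.dt * (K.area 0 * K.dx 3)) (by
      rw [smul_neg, K.vol_mul_X_three, neg_neg])
    rw [neg_eq_iff_eq_neg, K.area_zero, ← mul_assoc, ← mul_assoc] at h
    exact h
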